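/- Notation. $\mathbb D$ is the open unit disk, $\mathbb T$ the unit circle with normalized Lebesgue measure; $H^2(\mathbb D^2)$ and $H^2_2(\mathbb D)$ (variable $z_2$) are the Hardy spaces of the bidisk and of the disk, viewed through boundary values as subspaces of $L^2(\mathbb T^2)$ and $L^2(\mathbb T)$; $M_{z_j}$ is multiplication by $z_j$, and $P_{\mathcal S}$ is the orthogonal projection onto a closed subspace $\mathcal S$. For a bounded $m\times m$ matrix-valued function $F$ on $\mathbb T$, the Toeplitz operator $T_F$ on $H^2_2(\mathbb D)^m$ is $T_F\vec f=P_{H^2_2(\mathbb D)^m}(F\vec f)$, with $P_{H^2_2(\mathbb D)^m}$ the orthogonal projection of $L^2(\mathbb T)^m$ onto $H^2_2(\mathbb D)^m$. Theorem. Let $\Theta=\tilde p/p$ be rational inner of degree $(m,n)$ on $\mathbb D^2$; that is, $p\in\mathbb C[z_1,z_2]$ has degree at most $m$ in $z_1$ and at most $n$ in $z_2$ and no zeros in $\mathbb D^2$, and $p$ has no common factor with $\tilde p(z)=z_1^mz_2^n\overline{p(1/\bar z_1,1/\bar z_2)}$. Let $\mathcal K_\Theta=H^2(\mathbb D^2)\ominus\Theta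 H^2(\mathbb D^2)$, and let $\mathcal K_\Theta=\mathcal S_1\oplus\mathcal S_2$ be an orthogonal decomposition into closed subspaces such that $M_{z_1}\mathcal S_1\subseteq\mathcal S_1$ and $M_{z_2}\mathcal S_2\subseteq\mathcal S_2$. Then: 1. The space $\mathcal S_2\ominus z_2\mathcal S_2$ has an orthonormal basis $\{q_1/p,\dots,q_m/p\}$, where each $q_i$ is a polynomial of degree at most $m-1$ in $z_1$ and at most $n$ in $z_2$. 2. For every orthonormal basis $\{q_1/p,\dots,q_m/p\}$ of $\mathcal S_2\ominus z_2\mathcal S_2$ with polynomials $q_i$, the formula $$\mathcal U\vec f=\sum_{i=1}^m\frac{q_i}{p}\,f_i,\qquad \vec f=(f_1,\dots,f_m)\in H^2_2(\mathbb D)^m,$$ defines a unitary operator $\mathcal U:H^2_2(\mathbb D)^m\to\mathcal S_2$, and there is an $m\times m$ matrix-valued function $M_\Theta$ on $\overline{\mathbb D}$, whose entries are rational functions of $\bar z_2$ (with no poles in $\overline{\mathbb D}$) and continuous on $\overline{\mathbb D}$, such that the compression $S^1_\Theta=P_{\mathcal S_2}M_{z_1}|_{\mathcal S_2}$ satisfies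 $$S^1_\Theta=\mathcal U\,T_{M_\Theta}\,\mathcal U^*.$$ -/

import Mathlib

open MeasureTheory MvPolynomial
open scoped ENNReal ComplexConjugate InnerProductSpace

noncomputable section

namespace BidiskModel

/-! ### Circle, torus and multiplication operators

The circle is parametrized by `x : UnitAddCircle`, with `z = exp (2 π i x)`, and carries normalized
Lebesgue measure; the torus carries the product measure.
-/

/-- Normalized Lebesgue measure on the circle. -/
abbrev circleMeasure : Measure UnitAddCircle := AddCircle.haarAddCircle

/-- Normalized Lebesgue measure on the two-dimensional torus. -/
abbrev torusMeasure : Measure (UnitAddTorus (Fin 2)) := Measure.pi fun _ => circleMeasure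

/-- `L²` of the circle. -/
abbrev L2Circle : Type := Lp ℂ 2 circleMeasure

/-- `L²` of the torus. -/
abbrev L2Torus : Type := Lp ℂ 2 torusMeasure

/-- The point `exp (2 π i x)` of the unit circle in `ℂ`. -/
def circlePt (x : UnitAddCircle) : ℂ := (AddCircle.toCircle x : ℂ)

/-- The point `(exp (2 π i x₁), exp (2 π i x₂))` of the torus in `ℂ²`; coordinate `0` is the
variable `z₁`, coordinate `1` is the variable `z₂`. -/
def torusPt (x : UnitAddTorus (Fin 2)) : Fin 2 → ℂ := fun i => circlePt (x i)

/-- Multiplication by an essentially bounded function `φ`, as a bounded operator on `L²`. -/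
def mulOp {X : Type*} [MeasurableSpace X] {μ : Measure X} (φ : X → ℂ) (hφ : MemLp φ ∞ μ) :
    Lp ℂ 2 μ →L[ℂ] Lp ℂ 2 μ :=
  (ContinuousLinearMap.mul ℂ ℂ).holderL μ ∞ 2 2 (hφ.toLp φ)

theorem coeFn_mulOp {X : Type*} [MeasurableSpace X] {μ : Measure X} (φ : X → ℂ)
    (hφ : MemLp φ ∞ μ) (f : Lp ℂ 2 μ) :
    mulOp φ hφ f =ᵐ[μ] fun x => φ x * f x := by
  have h := (ContinuousLinearMap.mul ℂ ℂ).coeFn_holder (r := 2) (hφ.toLp φ) f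
  filter_upwards [h, hφ.coeFn_toLp] with x hx hx'
  rw [hx'] at hx
  exact hx

/-- The compression `P_S T |_S` of an operator `T` to a closed subspace `S`. -/
def compression {E : Type*} [NormedAddCommGroup E] [InnerProductSpace ℂ E] (S : Submodule ℂ E)
    [S.HasOrthogonalProjection] (T : E →L[ℂ] E) : S →L[ℂ] S :=
  S.orthogonalProjectionOnto ∘L T ∘L S.subtypeL

/-! ### Hardy spaces, identified with their spaces of boundary functions -/

/-- The Hardy space `H²(𝔻)`, realized as the boundary functions in `L²` of the circle whose
Fourier coefficients of negative index vanish. -/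
def hardyDisk : Submodule ℂ L2Circle where
  carrier := {f | ∀ k : ℤ, k < 0 → fourierCoeff f k = 0}
  zero_mem' := fun k _ => by
    rw [← fourierBasis_repr]; simp
  add_mem' := fun {f g} hf hg k hk => by
    rw [← fourierBasis_repr, map_add]
    have h1 := hf k hk
    have h2 := hg k hk
    rw [← fourierBasis_repr] at h1 h2
    simp [h1, h2]
  smul_mem' := fun c f hf k hk => by
    rw [← fourierBasis_repr, map_smul]
    have h1 := hf k hk
    rw [← fourierBasis_repr] at h1
    simp [h1]

/-- The Hardy space `H²(𝔻²)`, realized as the boundary functions in `L²` of the torus whose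
Fourier coefficients vanish at every index with a negative component. -/
def hardyBidisk : Submodule ℂ L2Torus where
  carrier := {f | ∀ k : Fin 2 → ℤ, (∃ i, k i < 0) → UnitAddTorus.mFourierCoeff f k = 0}
  zero_mem' := fun k _ => by
    rw [← UnitAddTorus.mFourierBasis_repr, map_zero]; simp
  add_mem' := fun {f g} hf hg k hk => by
    rw [← UnitAddTorus.mFourierBasis_repr, map_add]
    have h1 := hf k hk
    have h2 := hg k hk
    rw [← UnitAddTorus.mFourierBasis_repr] at h1 h2
    simp [h1, h2]
  smul_mem' := fun c f hf k hk => by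
    rw [← UnitAddTorus.mFourierBasis_repr, map_smul]
    have h1 := hf k hk
    rw [← UnitAddTorus.mFourierBasis_repr] at h1
    simp [h1]

theorem isClosed_hardyDisk : IsClosed (hardyDisk : Set L2Circle) := by
  have : (hardyDisk : Set L2Circle) =
      ⋂ k : ℤ, ⋂ _ : k < 0, {f | ⟪fourierBasis k, f⟫_ℂ = 0} := by
    ext f
    simp only [Set.mem_iInter, Set.mem_ofPred_eq, ← HilbertBasis.repr_apply_apply,
      fourierBasis_repr]
    rfl
  rw [this]
  exact isClosed_iInter fun k => isClosed_iInter fun _ =>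
    isClosed_eq (by fun_prop) continuous_const

/-- `L²(𝕋)^m`, the Hilbert space direct sum of `m` copies of `L²` of the circle. -/
abbrev L2CircleVec (m : ℕ) : Type := PiLp 2 fun _ : Fin m => L2Circle

/-- `H²(𝔻)^m`, as a subspace of `L²(𝕋)^m`. -/
def hardyVec (m : ℕ) : Submodule ℂ (L2CircleVec m) where
  carrier := {f | ∀ i, f i ∈ hardyDisk}
  zero_mem' := fun i => by simp
  add_mem' := fun hf hg i => by simpa using hardyDisk.add_mem (hf i) (hg i)
  smul_mem' := fun c f hf i => by simpa using hardyDisk.smul_mem c (hf i)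

instance (m : ℕ) : CompleteSpace (hardyVec m) := by
  have : IsClosed (hardyVec m : Set (L2CircleVec m)) := by
    have h : (hardyVec m : Set (L2CircleVec m)) =
        ⋂ i : Fin m, (fun f : L2CircleVec m => f i) ⁻¹' (hardyDisk : Set L2Circle) := by
      ext f
      simp only [Set.mem_iInter, Set.mem_preimage]
      rfl
    rw [h]
    exact isClosed_iInter fun i => isClosed_hardyDisk.preimage (by fun_prop)
  exact this.completeSpace_coe

/-- Multiplication `f ↦ F f` by a bounded matrix-valued function `F` on `L²(𝕋)^m`:
`(F f)_i = ∑ j, F_ij f_j`. -/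
def matMulOp {m : ℕ} (F : UnitAddCircle → Matrix (Fin m) (Fin m) ℂ)
    (hF : ∀ i j, MemLp (fun x => F x i j) ∞ circleMeasure) :
    L2CircleVec m →L[ℂ] L2CircleVec m :=
  (PiLp.continuousLinearEquiv 2 ℂ fun _ : Fin m => L2Circle).symm.toContinuousLinearMap ∘L
    ContinuousLinearMap.pi fun i => ∑ j, mulOp (fun x => F x i j) (hF i j) ∘L
      PiLp.proj 2 (fun _ : Fin m => L2Circle) j

/-- The matrix-valued Toeplitz operator `T_F f = P (F f)` on `H²(𝔻)^m`, where `P` is the orthogonal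
projection of `L²(𝕋)^m` onto `H²(𝔻)^m`. -/
def toeplitz {m : ℕ} (F : UnitAddCircle → Matrix (Fin m) (Fin m) ℂ)
    (hF : ∀ i j, MemLp (fun x => F x i j) ∞ circleMeasure) :
    hardyVec m →L[ℂ] hardyVec m :=
  compression (hardyVec m) (matMulOp F hF)

/-! ### Rational inner functions -/

/-- The reflection `p̃(z) = z₁^m z₂^n conj (p (1 / conj z₁, 1 / conj z₂))` of a polynomial `p` of
degree at most `(m, n)`, written out on coefficients; see `eval_reflection`. -/
def reflection (m n : ℕ) (p : MvPolynomial (Fin 2) ℂ) : MvPolynomial (Fin 2) ℂ :=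
  ∑ k ∈ p.support, C (conj (p.coeff k)) * X 0 ^ (m - k 0) * X 1 ^ (n - k 1)

theorem eval_reflection {m n : ℕ} {p : MvPolynomial (Fin 2) ℂ} (hm : p.degreeOf 0 ≤ m)
    (hn : p.degreeOf 1 ≤ n) (z : Fin 2 → ℂ) (h0 : z 0 ≠ 0) (h1 : z 1 ≠ 0) :
    eval z (reflection m n p) = z 0 ^ m * z 1 ^ n * conj (eval (fun i => 1 / conj (z i)) p) := by
  rw [reflection, map_sum, eval_eq' _ p, map_sum, Finset.mul_sum]
  refine Finset.sum_congr rfl fun k hk => ?_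
  have e0 : k 0 ≤ m := (monomial_le_degreeOf 0 hk).trans hm
  have e1 : k 1 ≤ n := (monomial_le_degreeOf 1 hk).trans hn
  have i0 : (1 / z 0) ^ k 0 = (z 0 ^ k 0)⁻¹ := by rw [one_div, inv_pow]
  have i1 : (1 / z 1) ^ k 1 = (z 1 ^ k 1)⁻¹ := by rw [one_div, inv_pow]
  simp only [map_mul, map_pow, eval_C, eval_X, Fin.prod_univ_two, map_div₀, map_one,
    Complex.conj_conj, pow_sub₀ _ h0 e0, pow_sub₀ _ h1 e1, i0, i1]
  ring

/-- `p` is the denominator of a rational inner function `p̃ / p` of degree `(m, n)` on the bidisk, in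
its canonical form: `p` has degree at most `(m, n)` and no zeros in `𝔻²`, and `p`, `p̃` have no
common factor. -/
structure IsInnerDenominator (m n : ℕ) (p : MvPolynomial (Fin 2) ℂ) : Prop where
  degree_fst : p.degreeOf 0 ≤ m
  degree_snd : p.degreeOf 1 ≤ n
  ne_zero : ∀ z : Fin 2 → ℂ, (∀ i, ‖z i‖ < 1) → eval z p ≠ 0
  coprime : IsRelPrime p (reflection m n p)

/-- The rational inner function `Θ = p̃ / p`, as a function of `(z₁, z₂)`. -/
def rationalInner (m n : ℕ) (p : MvPolynomial (Fin 2) ℂ) (z : Fin 2 → ℂ) : ℂ :=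
  eval z (reflection m n p) / eval z p

theorem norm_circlePt (x : UnitAddCircle) : ‖circlePt x‖ = 1 :=
  Circle.norm_coe _

theorem continuous_circlePt : Continuous circlePt :=
  continuous_subtype_val.comp AddCircle.continuous_toCircle

theorem continuous_torusPt : Continuous torusPt :=
  continuous_pi fun i => continuous_circlePt.comp (continuous_apply i)

theorem memLp_coordinate (i : Fin 2) : MemLp (fun x => torusPt x i) ∞ torusMeasure :=
  memLp_top_of_bound
    ((continuous_apply i).comp continuous_torusPt).aestronglyMeasurable 1
    (.of_forall fun x => (norm_circlePt (x i)).le)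

/-- On the torus `|p̃| = |p|`, so the boundary function of `p̃ / p` is bounded. -/
theorem IsInnerDenominator.memLp {m n : ℕ} {p : MvPolynomial (Fin 2) ℂ}
    (h : IsInnerDenominator m n p) :
    MemLp (fun x => rationalInner m n p (torusPt x)) ∞ torusMeasure := by
  refine memLp_top_of_bound (C := 1) ?_ (.of_forall fun x => ?_)
  · have hc : ∀ q : MvPolynomial (Fin 2) ℂ, Measurable fun x => eval (torusPt x) q := fun q =>
      ((MvPolynomial.continuous_eval q).comp continuous_torusPt).measurable
    exact ((hc _).div (hc _)).aestronglyMeasurable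
  · have hn : ∀ i, ‖torusPt x i‖ = 1 := fun i => norm_circlePt (x i)
    have hz : ∀ i, torusPt x i ≠ 0 := fun i => norm_ne_zero_iff.1 (by simp [hn i])
    have hconj : (fun i => 1 / conj (torusPt x i)) = torusPt x := by
      funext i
      rw [one_div, ← Complex.inv_eq_conj (hn i), inv_inv]
    rw [rationalInner, eval_reflection h.degree_fst h.degree_snd _ (hz 0) (hz 1), hconj]
    simp only [norm_div, norm_mul, norm_pow, hn, one_pow, one_mul, RCLike.norm_conj]
    exact div_self_le_one _

/-! ### Model spaces and their decompositions -/

/-- The operator `M_{z₁}` (for `i = 0`) or `M_{z₂}` (for `i = 1`) of multiplication by a coordinate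
function. -/
def coordMul (i : Fin 2) : L2Torus →L[ℂ] L2Torus :=
  mulOp (fun x => torusPt x i) (memLp_coordinate i)

/-- The model space `K_Θ = H²(𝔻²) ⊖ Θ H²(𝔻²)`. -/
def modelSpace (Θ : UnitAddTorus (Fin 2) → ℂ) (hΘ : MemLp Θ ∞ torusMeasure) :
    Submodule ℂ L2Torus :=
  hardyBidisk ⊓ (hardyBidisk.map (mulOp Θ hΘ).toLinearMap)ᗮ

/-- `K = S₁ ⊕ S₂` is an orthogonal decomposition in which `S₁` is invariant under `M_{z₁}` and `S₂`
is invariant under `M_{z₂}`. -/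
structure IsInvariantDecomposition (K S₁ S₂ : Submodule ℂ L2Torus) : Prop where
  orthogonal : S₁ ⟂ S₂
  sup_eq : S₁ ⊔ S₂ = K
  invariant_fst : S₁.map (coordMul 0).toLinearMap ≤ S₁
  invariant_snd : S₂.map (coordMul 1).toLinearMap ≤ S₂

/-- The subspace `S₂ ⊖ z₂ S₂`. -/
def wandering (S₂ : Submodule ℂ L2Torus) : Submodule ℂ L2Torus :=
  S₂ ⊓ (S₂.map (coordMul 1).toLinearMap)ᗮ

/-- The functions `q₁ / p, …, q_m / p` form an orthonormal basis of `S₂ ⊖ z₂ S₂`. -/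
def IsWanderingBasis {m : ℕ} (p : MvPolynomial (Fin 2) ℂ) (S₂ : Submodule ℂ L2Torus)
    (q : Fin m → MvPolynomial (Fin 2) ℂ) : Prop :=
  ∃ e : Fin m → L2Torus,
    (∀ i, e i =ᵐ[torusMeasure] fun x => eval (torusPt x) (q i) / eval (torusPt x) p) ∧
    Orthonormal ℂ e ∧ Submodule.span ℂ (Set.range e) = wandering S₂

/-- `g` is, on the closed unit disk, a rational function of `conj z`: a quotient of polynomials
in `conj z` whose denominator has no zero there. -/
def IsRationalInConj (g : ℂ → ℂ) : Prop :=
  ∃ a b : Polynomial ℂ, ∀ z ∈ Metric.closedBall (0 : ℂ) 1,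
    b.eval (conj z) ≠ 0 ∧ g z = a.eval (conj z) / b.eval (conj z)

end BidiskModel

end

noncomputable section

namespace BidiskModel

/-! ### Multiplication operators -/

section MulOp

variable {X : Type*} [MeasurableSpace X] {μ : Measure X}

/-! Write `Θ = p̃/p`, and let `B_i` be the backward shift on `H²` in `z_i`, the adjoint of
multiplication by `z_i`. Since `|Θ| = 1` almost everywhere on the torus, `p f = p̃ (conj Θ f)`, so
vanishing of Fourier coefficients of `conj Θ f` becomes a degree bound on `p f`. If `z₂^l f` lies in
the model space for all `l`, then `p f` has `z₁`-degree below `m`; this applies to `S₂`, and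
symmetrically `p S₁` has `z₂`-degree below `n` (`torusCoeff_polyOp_of_shift_mem_model`). For `x` in
`W = S₂ ⊖ z₂S₂`, the function `B₂x` lies in `S₁`, and `x - z₂B₂x` depends on `z₁` only, so `p x` has
`z₂`-degree at most `n`. Hence `W` is finite-dimensional and consists of quotients `q/p`.

The Wold decomposition of multiplication by `z₂` on `S₂` has no unitary part inside `H²`, so an
orthonormal basis `e_i = q_i/p` of `W` gives the unitary `U f = Σ e_i f_i` (`exists_unitary`).

That `dim W = m` is proved by two counts. The matrix over `ℂ[z₂]` of the `z₁`-coefficients of the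
`q_i` is injective, so `dim W ≤ m` (`card_le`). If `dim W < m`, linear algebra on polynomials of
`z₁`-degree below `m` yields a nonzero `A` with `p A = p̃ r`; coprimality gives `p̃ ∣ A`, against
the `z₁`-degree `m` of `p̃` (`le_card`).

For the compression, put `G_i = U* B₁ e_i`. In the basis `z₂^k e_i` the matrix of the compression of
`M_{z₁}` depends only on the difference of the powers of `z₂`, and it is the Toeplitz matrix with
symbol `M_ij = conj (G_i)_j` (`inner_shift_coordMul`). Comparing powers of `z₁` in the equation
defining `B₁ e_i` gives a linear system over `ℂ[z₂]` for the entries of `G_i`, with nonzero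
determinant. So these entries are rational, and membership in `H²` excludes poles in the closed disk
(`exists_eq_div_of_mem_hardyDisk`). -/

theorem mulOp_eq_of_ae {φ : X → ℂ} (hφ : MemLp φ ∞ μ) {f g : Lp ℂ 2 μ}
    (h : ∀ᵐ x ∂μ, φ x * f x = g x) : mulOp φ hφ f = g := by
  refine Lp.ext ?_
  filter_upwards [coeFn_mulOp φ hφ f, h] with x h1 h2
  rw [h1, h2]

theorem coeFn_Lp_sum {ι : Type*} (s : Finset ι) (f : ι → Lp ℂ 2 μ) :
    ((∑ i ∈ s, f i : Lp ℂ 2 μ) : X → ℂ) =ᵐ[μ] fun x => ∑ i ∈ s, f i x := by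
  classical
  induction s using Finset.induction_on with
  | empty =>
    simp only [Finset.sum_empty]
    exact Lp.coeFn_zero ℂ 2 μ
  | insert i s hi ih =>
    rw [Finset.sum_insert hi]
    filter_upwards [Lp.coeFn_add (f i) (∑ i ∈ s, f i), ih] with x h1 h2
    rw [h1, Pi.add_apply, h2, Finset.sum_insert hi]

theorem mulOp_mulOp {φ ψ χ : X → ℂ} (hφ : MemLp φ ∞ μ) (hψ : MemLp ψ ∞ μ) (hχ : MemLp χ ∞ μ)
    (h : ∀ᵐ x ∂μ, φ x * ψ x = χ x) (f : Lp ℂ 2 μ) :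
    mulOp φ hφ (mulOp ψ hψ f) = mulOp χ hχ f := by
  refine mulOp_eq_of_ae hφ ?_
  filter_upwards [coeFn_mulOp ψ hψ f, coeFn_mulOp χ hχ f, h] with x h1 h2 h3
  rw [h1, h2, ← h3, mul_assoc]

theorem mulOp_comm {φ ψ : X → ℂ} (hφ : MemLp φ ∞ μ) (hψ : MemLp ψ ∞ μ) (f : Lp ℂ 2 μ) :
    mulOp φ hφ (mulOp ψ hψ f) = mulOp ψ hψ (mulOp φ hφ f) := by
  refine mulOp_eq_of_ae hφ ?_
  filter_upwards [coeFn_mulOp ψ hψ f, coeFn_mulOp ψ hψ (mulOp φ hφ f),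
    coeFn_mulOp φ hφ f] with x h1 h2 h3
  rw [h1, h2, h3]
  ring

theorem mulOp_eq_self {φ : X → ℂ} (hφ : MemLp φ ∞ μ) (h : ∀ᵐ x ∂μ, φ x = 1) (f : Lp ℂ 2 μ) :
    mulOp φ hφ f = f := by
  refine mulOp_eq_of_ae hφ ?_
  filter_upwards [h] with x h1
  rw [h1, one_mul]

theorem memLp_conj {φ : X → ℂ} (hφ : MemLp φ ∞ μ) : MemLp (fun x => conj (φ x)) ∞ μ :=
  hφ.star

theorem inner_mulOp_left {φ : X → ℂ} (hφ : MemLp φ ∞ μ) (f g : Lp ℂ 2 μ) :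
    ⟪mulOp φ hφ f, g⟫_ℂ = ⟪f, mulOp (fun x => conj (φ x)) (memLp_conj hφ) g⟫_ℂ := by
  rw [L2.inner_def, L2.inner_def]
  refine integral_congr_ae ?_
  filter_upwards [coeFn_mulOp φ hφ f, coeFn_mulOp _ (memLp_conj hφ) g] with x h1 h2
  rw [h1, h2]
  simp only [RCLike.inner_apply, map_mul]
  ring

theorem inner_mulOp_right {φ : X → ℂ} (hφ : MemLp φ ∞ μ) (f g : Lp ℂ 2 μ) :
    ⟪f, mulOp φ hφ g⟫_ℂ = ⟪mulOp (fun x => conj (φ x)) (memLp_conj hφ) f, g⟫_ℂ := by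
  rw [← inner_conj_symm, inner_mulOp_left, inner_conj_symm]

end MulOp

/-! ### Fourier coefficients on the torus -/

/-- The character `z₁^k₁ z₂^k₂` as an element of `L²` of the torus. -/
def torusChar (k : Fin 2 → ℤ) : L2Torus := UnitAddTorus.mFourierLp 2 k

/-- The characters as a Hilbert basis. -/
def torusBasis : HilbertBasis (Fin 2 → ℤ) ℂ L2Torus := UnitAddTorus.mFourierBasis

/-- The Fourier coefficient of index `k`. -/
def torusCoeff (k : Fin 2 → ℤ) : L2Torus →L[ℂ] ℂ := innerSL ℂ (torusChar k)

theorem torusBasis_apply (k : Fin 2 → ℤ) : torusBasis k = torusChar k := by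
  rw [torusBasis, UnitAddTorus.coe_mFourierBasis, torusChar]

theorem torusCoeff_apply (k : Fin 2 → ℤ) (f : L2Torus) : torusCoeff k f = ⟪torusChar k, f⟫_ℂ := rfl

theorem mFourierCoeff_eq (k : Fin 2 → ℤ) (f : L2Torus) :
    UnitAddTorus.mFourierCoeff f k = torusCoeff k f := by
  rw [torusCoeff_apply, ← torusBasis_apply, ← HilbertBasis.repr_apply_apply, torusBasis,
    ← UnitAddTorus.mFourierBasis_repr]

theorem mem_hardyBidisk {f : L2Torus} :
    f ∈ hardyBidisk ↔ ∀ k, (∃ i, k i < 0) → torusCoeff k f = 0 := by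
  simp only [← mFourierCoeff_eq]
  rfl

theorem torus_ext {f g : L2Torus} (h : ∀ k, torusCoeff k f = torusCoeff k g) : f = g := by
  refine torusBasis.repr.injective (lp.ext (funext fun k => ?_))
  rw [HilbertBasis.repr_apply_apply, HilbertBasis.repr_apply_apply, torusBasis_apply]
  exact h k

/-- Parseval: functions with disjoint Fourier supports are orthogonal. The support arguments below
use orthogonality in this form. -/
theorem inner_eq_zero_of_torusCoeff {f g : L2Torus}
    (h : ∀ k, torusCoeff k f = 0 ∨ torusCoeff k g = 0) : ⟪f, g⟫_ℂ = 0 := by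
  rw [← torusBasis.tsum_inner_mul_inner]
  refine (tsum_congr fun k => ?_).trans tsum_zero
  rw [torusBasis_apply]
  rcases h k with h | h
  · rw [torusCoeff_apply] at h
    rw [← inner_conj_symm, h, map_zero, zero_mul]
  · rw [torusCoeff_apply] at h
    rw [h, mul_zero]

theorem orthonormal_torusChar : Orthonormal ℂ torusChar := by
  have := torusBasis.orthonormal
  rwa [show (⇑torusBasis) = torusChar from funext torusBasis_apply] at this

theorem torusCoeff_torusChar (k l : Fin 2 → ℤ) :
    torusCoeff k (torusChar l) = if k = l then 1 else 0 :=
  orthonormal_iff_ite.1 orthonormal_torusChar k l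

theorem memLp_mFourier (k : Fin 2 → ℤ) :
    MemLp (fun x => UnitAddTorus.mFourier k x) ∞ torusMeasure :=
  memLp_top_of_bound (UnitAddTorus.mFourier k).continuous.aestronglyMeasurable 1
    (.of_forall fun x => ((UnitAddTorus.mFourier k).norm_coe_le_norm x).trans
      UnitAddTorus.mFourier_norm.le)

/-- Multiplication by a character. -/
def charOp (k : Fin 2 → ℤ) : L2Torus →L[ℂ] L2Torus := mulOp _ (memLp_mFourier k)

theorem coeFn_torusChar (k : Fin 2 → ℤ) :
    torusChar k =ᵐ[torusMeasure] fun x => UnitAddTorus.mFourier k x :=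
  UnitAddTorus.coeFn_mFourierLp 2 k

theorem charOp_torusChar (k l : Fin 2 → ℤ) : charOp k (torusChar l) = torusChar (k + l) := by
  refine mulOp_eq_of_ae _ ?_
  filter_upwards [coeFn_torusChar l, coeFn_torusChar (k + l)] with x h1 h2
  rw [h1, h2, UnitAddTorus.mFourier_add]

theorem charOp_zero (f : L2Torus) : charOp 0 f = f :=
  mulOp_eq_self _ (.of_forall fun x => by rw [UnitAddTorus.mFourier_zero]; rfl) f

theorem charOp_charOp (k l : Fin 2 → ℤ) (f : L2Torus) :
    charOp k (charOp l f) = charOp (k + l) f :=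
  mulOp_mulOp _ _ _ (.of_forall fun x => by rw [UnitAddTorus.mFourier_add]) f

theorem inner_charOp_left (k : Fin 2 → ℤ) (f g : L2Torus) :
    ⟪charOp k f, g⟫_ℂ = ⟪f, charOp (-k) g⟫_ℂ := by
  rw [charOp, inner_mulOp_left]
  congr 1
  refine mulOp_eq_of_ae _ ?_
  filter_upwards [coeFn_mulOp _ (memLp_mFourier (-k)) g] with x h
  rw [charOp, h, UnitAddTorus.mFourier_neg]

theorem inner_charOp_right (k : Fin 2 → ℤ) (f g : L2Torus) :
    ⟪f, charOp k g⟫_ℂ = ⟪charOp (-k) f, g⟫_ℂ := by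
  rw [inner_charOp_left, neg_neg]

theorem torusCoeff_charOp (k l : Fin 2 → ℤ) (f : L2Torus) :
    torusCoeff k (charOp l f) = torusCoeff (k - l) f := by
  rw [torusCoeff_apply, torusCoeff_apply, inner_charOp_right, charOp_torusChar,
    neg_add_eq_sub]

theorem mFourier_eq_zpow (k : Fin 2 → ℤ) (x : UnitAddTorus (Fin 2)) :
    UnitAddTorus.mFourier k x = torusPt x 0 ^ k 0 * torusPt x 1 ^ k 1 := by
  simp only [UnitAddTorus.mFourier, ContinuousMap.coe_mk, Fin.prod_univ_two, fourier_apply,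
    AddCircle.toCircle_zsmul, Circle.coe_zpow, torusPt, circlePt]

theorem mFourier_single_eq (i : Fin 2) (x : UnitAddTorus (Fin 2)) :
    UnitAddTorus.mFourier (Pi.single i 1) x = torusPt x i := by
  rw [UnitAddTorus.mFourier_single, fourier_one]; rfl

theorem coordMul_eq (i : Fin 2) : coordMul i = charOp (Pi.single i 1) := by
  ext1 f
  refine mulOp_eq_of_ae _ ?_
  filter_upwards [coeFn_mulOp _ (memLp_mFourier (Pi.single i 1)) f] with x h
  rw [charOp, h, mFourier_single_eq]

/-! ### Multiplication by polynomials on the torus -/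

/-- An exponent of a polynomial as an element of the dual group `ℤ²`. -/
def expo (a : Fin 2 →₀ ℕ) : Fin 2 → ℤ := fun i => (a i : ℤ)

theorem expo_injective : Function.Injective expo := fun a b h =>
  Finsupp.ext fun i => by simpa [expo] using congrFun h i

theorem eval_torusPt_eq (q : MvPolynomial (Fin 2) ℂ) (x : UnitAddTorus (Fin 2)) :
    eval (torusPt x) q = ∑ a ∈ q.support, q.coeff a * UnitAddTorus.mFourier (expo a) x := by
  rw [eval_eq']
  refine Finset.sum_congr rfl fun a _ => ?_
  rw [mFourier_eq_zpow, Fin.prod_univ_two]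
  simp [expo]

theorem continuous_eval_torusPt (q : MvPolynomial (Fin 2) ℂ) :
    Continuous fun x => eval (torusPt x) q :=
  (MvPolynomial.continuous_eval q).comp continuous_torusPt

theorem memLp_eval (q : MvPolynomial (Fin 2) ℂ) :
    MemLp (fun x => eval (torusPt x) q) ∞ torusMeasure := by
  obtain ⟨C, hC⟩ := isCompact_univ.exists_bound_of_continuousOn
    (continuous_eval_torusPt q).continuousOn
  exact memLp_top_of_bound (continuous_eval_torusPt q).aestronglyMeasurable C
    (.of_forall fun x => hC x (Set.mem_univ x))

/-- Multiplication by a polynomial. -/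
def polyOp (q : MvPolynomial (Fin 2) ℂ) : L2Torus →L[ℂ] L2Torus := mulOp _ (memLp_eval q)

theorem polyOp_eq_sum (q : MvPolynomial (Fin 2) ℂ) (f : L2Torus) :
    polyOp q f = ∑ a ∈ q.support, q.coeff a • charOp (expo a) f := by
  refine mulOp_eq_of_ae _ ?_
  have h2 : ∀ᵐ x ∂torusMeasure, ∀ a ∈ q.support,
      (q.coeff a • charOp (expo a) f : L2Torus) x =
        q.coeff a * (UnitAddTorus.mFourier (expo a) x * f x) := by
    rw [Filter.eventually_all_finset]
    intro a _
    filter_upwards [Lp.coeFn_smul (q.coeff a) (charOp (expo a) f),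
      coeFn_mulOp _ (memLp_mFourier (expo a)) f] with x h1 h3
    rw [h1, Pi.smul_apply, charOp, h3, smul_eq_mul]
  filter_upwards [coeFn_Lp_sum q.support fun a => q.coeff a • charOp (expo a) f, h2] with x h1 h3
  rw [h1, Finset.sum_congr rfl h3, eval_torusPt_eq, Finset.sum_mul]
  exact Finset.sum_congr rfl fun a _ => by ring

/-- A finite convolution, from which the degree and support statements about products with
polynomials are read off. -/
theorem torusCoeff_polyOp (q : MvPolynomial (Fin 2) ℂ) (f : L2Torus) (k : Fin 2 → ℤ) :
    torusCoeff k (polyOp q f) = ∑ a ∈ q.support, q.coeff a * torusCoeff (k - expo a) f := by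
  simp only [polyOp_eq_sum, map_sum, map_smul, torusCoeff_charOp, smul_eq_mul]

theorem polyOp_mul (q r : MvPolynomial (Fin 2) ℂ) (f : L2Torus) :
    polyOp (q * r) f = polyOp q (polyOp r f) :=
  (mulOp_mulOp _ _ _ (.of_forall fun _ => (map_mul _ _ _).symm) f).symm

theorem polyOp_charOp (q : MvPolynomial (Fin 2) ℂ) (k : Fin 2 → ℤ) (f : L2Torus) :
    polyOp q (charOp k f) = charOp k (polyOp q f) :=
  mulOp_comm _ _ f

/-- The boundary function of a polynomial. -/
def polyFn (q : MvPolynomial (Fin 2) ℂ) : L2Torus := polyOp q (torusChar 0)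

theorem coeFn_polyFn (q : MvPolynomial (Fin 2) ℂ) :
    polyFn q =ᵐ[torusMeasure] fun x => eval (torusPt x) q := by
  filter_upwards [coeFn_mulOp _ (memLp_eval q) (torusChar 0), coeFn_torusChar 0] with x h1 h2
  rw [polyFn, polyOp, h1, h2, UnitAddTorus.mFourier_zero, ContinuousMap.one_apply, mul_one]

theorem torusCoeff_polyFn (q : MvPolynomial (Fin 2) ℂ) (k : Fin 2 → ℤ) :
    torusCoeff k (polyFn q) = ∑ a ∈ q.support, if k = expo a then q.coeff a else 0 := by
  rw [polyFn, torusCoeff_polyOp]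
  refine Finset.sum_congr rfl fun a _ => ?_
  simp [torusCoeff_torusChar, sub_eq_zero]

theorem torusCoeff_polyFn_expo (q : MvPolynomial (Fin 2) ℂ) (a : Fin 2 →₀ ℕ) :
    torusCoeff (expo a) (polyFn q) = q.coeff a := by
  simp only [torusCoeff_polyFn, expo_injective.eq_iff, Finset.sum_ite_eq]
  simp +contextual [eq_comm]

theorem torusCoeff_polyFn_of_neg (q : MvPolynomial (Fin 2) ℂ) {k : Fin 2 → ℤ}
    (hk : ∃ i, k i < 0) : torusCoeff k (polyFn q) = 0 := by
  rw [torusCoeff_polyFn]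
  refine Finset.sum_eq_zero fun a _ => if_neg ?_
  rintro rfl
  obtain ⟨i, hi⟩ := hk
  simp [expo] at hi
  omega

theorem exists_expo_eq {k : Fin 2 → ℤ} (hk : ¬ ∃ i, k i < 0) : ∃ a, expo a = k := by
  push Not at hk
  exact ⟨Finsupp.equivFunOnFinite.symm fun i => (k i).toNat, funext fun i => by
    simp [expo, hk i]⟩

theorem polyFn_injective : Function.Injective polyFn := fun q r h => by
  ext a
  rw [← torusCoeff_polyFn_expo, h, torusCoeff_polyFn_expo]

/-- An element of `H²` with finitely many nonzero Fourier coefficients is a polynomial. -/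
theorem exists_polyFn_eq {f : L2Torus} (hf : f ∈ hardyBidisk) (N : Fin 2 → ℕ)
    (h : ∀ k i, (N i : ℤ) < k i → torusCoeff k f = 0) :
    ∃ q : MvPolynomial (Fin 2) ℂ, polyFn q = f ∧ ∀ i, q.degreeOf i ≤ N i := by
  classical
  let s : Finset (Fin 2 →₀ ℕ) := Finset.Iic (Finsupp.equivFunOnFinite.symm N)
  have hs : ∀ a, a ∉ s → torusCoeff (expo a) f = 0 := by
    intro a ha
    have : ∃ i, N i < a i := by
      by_contra! hc
      exact ha (Finset.mem_Iic.2 fun i => by simpa using hc i)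
    obtain ⟨i, hi⟩ := this
    exact h _ i (by simpa [expo] using hi)
  let q : MvPolynomial (Fin 2) ℂ := ∑ a ∈ s, monomial a (torusCoeff (expo a) f)
  have hq : ∀ a, q.coeff a = torusCoeff (expo a) f := by
    intro a
    simp only [q, coeff_sum, coeff_monomial, Finset.sum_ite_eq']
    split_ifs with ha
    · rfl
    · exact (hs a ha).symm
  refine ⟨q, torus_ext fun k => ?_, fun i => ?_⟩
  · by_cases hk : ∃ i, k i < 0
    · rw [torusCoeff_polyFn_of_neg q hk, mem_hardyBidisk.1 hf k hk]
    · obtain ⟨a, rfl⟩ := exists_expo_eq hk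
      rw [torusCoeff_polyFn_expo, hq]
  · rw [degreeOf_le_iff]
    intro a ha
    by_contra! hc
    rw [mem_support_iff, hq] at ha
    exact ha (h _ i (by simpa [expo] using hc))

theorem polyOp_polyFn (q r : MvPolynomial (Fin 2) ℂ) : polyOp q (polyFn r) = polyFn (q * r) :=
  (polyOp_mul _ _ _).symm

theorem polyOp_mem (q : MvPolynomial (Fin 2) ℂ) {f : L2Torus} (hf : f ∈ hardyBidisk) :
    polyOp q f ∈ hardyBidisk := by
  rw [mem_hardyBidisk] at hf ⊢
  rintro k ⟨i, hi⟩
  rw [torusCoeff_polyOp]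
  refine Finset.sum_eq_zero fun a _ => ?_
  rw [hf _ ⟨i, ?_⟩, mul_zero]
  simp only [Pi.sub_apply, expo]
  omega

/-- If the coefficients of `f` vanish at all indices with `i`-th component at least `r`, then those
of `q f` vanish at all indices with `i`-th component at least `r + D`, where `D` bounds the degree
of `q` in the variable `i`. -/
theorem torusCoeff_polyOp_eq_zero {q : MvPolynomial (Fin 2) ℂ} {f : L2Torus} {i : Fin 2} {D : ℕ}
    {r : ℤ} (hq : q.degreeOf i ≤ D) (hf : ∀ k, r ≤ k i → torusCoeff k f = 0)
    {k : Fin 2 → ℤ} (hk : r + D ≤ k i) : torusCoeff k (polyOp q f) = 0 := by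
  rw [torusCoeff_polyOp]
  refine Finset.sum_eq_zero fun a ha => ?_
  have := (monomial_le_degreeOf i ha).trans hq
  rw [hf, mul_zero]
  simp only [Pi.sub_apply, expo]
  omega

/-! ### Fourier coefficients on the circle -/

/-- The character `z^k` as an element of `L²` of the circle. -/
def circleChar (k : ℤ) : L2Circle := fourierLp 2 k

/-- The Fourier coefficient of index `k`. -/
def circleCoeff (k : ℤ) : L2Circle →L[ℂ] ℂ := innerSL ℂ (circleChar k)

theorem fourierBasis_apply (k : ℤ) : (fourierBasis k : L2Circle) = circleChar k := by
  rw [coe_fourierBasis, circleChar]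

theorem circleCoeff_apply (k : ℤ) (f : L2Circle) : circleCoeff k f = ⟪circleChar k, f⟫_ℂ := rfl

theorem fourierCoeff_eq (k : ℤ) (f : L2Circle) : fourierCoeff f k = circleCoeff k f := by
  rw [circleCoeff_apply, ← fourierBasis_apply, ← HilbertBasis.repr_apply_apply,
    fourierBasis_repr]

theorem mem_hardyDisk {f : L2Circle} : f ∈ hardyDisk ↔ ∀ k < 0, circleCoeff k f = 0 := by
  simp only [← fourierCoeff_eq]
  rfl

theorem circle_ext {f g : L2Circle} (h : ∀ k, circleCoeff k f = circleCoeff k g) : f = g := by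
  refine fourierBasis.repr.injective (lp.ext (funext fun k => ?_))
  rw [HilbertBasis.repr_apply_apply, HilbertBasis.repr_apply_apply, fourierBasis_apply]
  exact h k

theorem orthonormal_circleChar : Orthonormal ℂ circleChar := orthonormal_fourier

theorem circleCoeff_circleChar (k l : ℤ) :
    circleCoeff k (circleChar l) = if k = l then 1 else 0 :=
  orthonormal_iff_ite.1 orthonormal_circleChar k l

theorem coeFn_circleChar (k : ℤ) : circleChar k =ᵐ[circleMeasure] fun x => fourier k x :=
  coeFn_fourierLp 2 k

theorem fourier_eq_zpow (k : ℤ) (x : UnitAddCircle) : fourier k x = circlePt x ^ k := by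
  rw [fourier_apply, AddCircle.toCircle_zsmul, Circle.coe_zpow, circlePt]

/-- Bessel's inequality makes the squares summable. This decay is what defeats the geometric
recursions that arise on dividing by a linear factor. -/
theorem tendsto_circleCoeff (f : L2Circle) :
    Filter.Tendsto (fun k => ‖circleCoeff k f‖) Filter.cofinite (nhds 0) := by
  have h := (fourierBasis.orthonormal (𝕜 := ℂ)).inner_products_summable (x := f)
  have h2 := h.tendsto_cofinite_zero
  have h3 : Filter.Tendsto (fun k => √(‖circleCoeff k f‖ ^ 2)) Filter.cofinite (nhds √0) := by
    refine (Real.continuous_sqrt.tendsto 0).comp ?_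
    simpa only [fourierBasis_apply, ← circleCoeff_apply] using h2
  simpa [Real.sqrt_sq] using h3

theorem memLp_fourier (k : ℤ) : MemLp (fun x => fourier k x) ∞ circleMeasure :=
  memLp_top_of_bound (fourier k).continuous.aestronglyMeasurable 1
    (.of_forall fun x => ((fourier k).norm_coe_le_norm x).trans (fourier_norm k).le)

/-- Multiplication by a character of the circle. -/
def circleCharOp (k : ℤ) : L2Circle →L[ℂ] L2Circle := mulOp _ (memLp_fourier k)

theorem circleCharOp_circleChar (k l : ℤ) :
    circleCharOp k (circleChar l) = circleChar (k + l) := by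
  refine mulOp_eq_of_ae _ ?_
  filter_upwards [coeFn_circleChar l, coeFn_circleChar (k + l)] with x h1 h2
  rw [h1, h2, fourier_add]

theorem inner_circleCharOp_right (k : ℤ) (f g : L2Circle) :
    ⟪f, circleCharOp k g⟫_ℂ = ⟪circleCharOp (-k) f, g⟫_ℂ := by
  rw [circleCharOp, inner_mulOp_right]
  congr 1
  refine mulOp_eq_of_ae _ ?_
  filter_upwards [coeFn_mulOp _ (memLp_fourier (-k)) f] with x h
  rw [circleCharOp, h, fourier_neg]

theorem circleCoeff_circleCharOp (k l : ℤ) (f : L2Circle) :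
    circleCoeff k (circleCharOp l f) = circleCoeff (k - l) f := by
  rw [circleCoeff_apply, circleCoeff_apply, inner_circleCharOp_right, circleCharOp_circleChar,
    neg_add_eq_sub]

/-! ### Multiplication by polynomials on the circle -/

theorem continuous_eval_circlePt (P : Polynomial ℂ) : Continuous fun x => P.eval (circlePt x) :=
  P.continuous.comp continuous_circlePt

theorem memLp_circle_eval (P : Polynomial ℂ) :
    MemLp (fun x => P.eval (circlePt x)) ∞ circleMeasure := by
  obtain ⟨C, hC⟩ := isCompact_univ.exists_bound_of_continuousOn
    (continuous_eval_circlePt P).continuousOn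
  exact memLp_top_of_bound (continuous_eval_circlePt P).aestronglyMeasurable C
    (.of_forall fun x => hC x (Set.mem_univ x))

/-- Multiplication by a polynomial on the circle. -/
def circlePolyOp (P : Polynomial ℂ) : L2Circle →L[ℂ] L2Circle := mulOp _ (memLp_circle_eval P)

theorem circlePolyOp_eq_sum (P : Polynomial ℂ) (f : L2Circle) :
    circlePolyOp P f = ∑ a ∈ P.support, P.coeff a • circleCharOp a f := by
  refine mulOp_eq_of_ae _ ?_
  have h2 : ∀ᵐ x ∂circleMeasure, ∀ a ∈ P.support,
      (P.coeff a • circleCharOp a f : L2Circle) x = P.coeff a * (fourier a x * f x) := by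
    rw [Filter.eventually_all_finset]
    intro a _
    filter_upwards [Lp.coeFn_smul (P.coeff a) (circleCharOp a f),
      coeFn_mulOp _ (memLp_fourier a) f] with x h1 h3
    rw [h1, Pi.smul_apply, circleCharOp, h3, smul_eq_mul]
  filter_upwards [coeFn_Lp_sum P.support fun a => P.coeff a • circleCharOp a f, h2] with x h1 h3
  rw [h1, Finset.sum_congr rfl h3, Polynomial.eval_eq_sum, Polynomial.sum, Finset.sum_mul]
  exact Finset.sum_congr rfl fun a _ => by rw [fourier_eq_zpow, zpow_natCast]; ring

theorem circleCoeff_circlePolyOp (P : Polynomial ℂ) (f : L2Circle) (k : ℤ) :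
    circleCoeff k (circlePolyOp P f) = P.sum fun a c => c * circleCoeff (k - a) f := by
  simp only [circlePolyOp_eq_sum, map_sum, map_smul, circleCoeff_circleCharOp, smul_eq_mul,
    Polynomial.sum]

theorem circlePolyOp_mul (P Q : Polynomial ℂ) (f : L2Circle) :
    circlePolyOp (P * Q) f = circlePolyOp P (circlePolyOp Q f) :=
  (mulOp_mulOp _ _ _ (.of_forall fun _ => Polynomial.eval_mul.symm) f).symm

theorem circlePolyOp_add (P Q : Polynomial ℂ) (f : L2Circle) :
    circlePolyOp (P + Q) f = circlePolyOp P f + circlePolyOp Q f := by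
  refine mulOp_eq_of_ae _ ?_
  filter_upwards [coeFn_mulOp _ (memLp_circle_eval P) f, coeFn_mulOp _ (memLp_circle_eval Q) f,
    Lp.coeFn_add (circlePolyOp P f) (circlePolyOp Q f)] with x h1 h2 h3
  rw [h3, Pi.add_apply, circlePolyOp, circlePolyOp, h1, h2, Polynomial.eval_add]
  ring

theorem circlePolyOp_C (c : ℂ) (f : L2Circle) : circlePolyOp (Polynomial.C c) f = c • f := by
  refine mulOp_eq_of_ae _ ?_
  filter_upwards [Lp.coeFn_smul c f] with x h1
  rw [h1, Polynomial.eval_C, Pi.smul_apply, smul_eq_mul]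

theorem circlePolyOp_X (f : L2Circle) : circlePolyOp Polynomial.X f = circleCharOp 1 f := by
  refine mulOp_eq_of_ae _ ?_
  filter_upwards [coeFn_mulOp _ (memLp_fourier 1) f] with x h1
  rw [circleCharOp, h1, Polynomial.eval_X, fourier_eq_zpow, zpow_one]

theorem circlePolyOp_zero (f : L2Circle) : circlePolyOp 0 f = 0 := by
  rw [← Polynomial.C_0, circlePolyOp_C, zero_smul]

theorem circlePolyOp_sum {ι : Type*} (s : Finset ι) (P : ι → Polynomial ℂ) (f : L2Circle) :
    circlePolyOp (∑ i ∈ s, P i) f = ∑ i ∈ s, circlePolyOp (P i) f := by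
  classical
  induction s using Finset.induction_on with
  | empty => simp [circlePolyOp_zero]
  | insert i s hi ih => rw [Finset.sum_insert hi, Finset.sum_insert hi, circlePolyOp_add, ih]

theorem circlePolyOp_X_sub_C (c : ℂ) (f : L2Circle) :
    circlePolyOp (Polynomial.X - Polynomial.C c) f = circleCharOp 1 f - c • f := by
  rw [sub_eq_add_neg, ← Polynomial.C_neg, circlePolyOp_add, circlePolyOp_X, circlePolyOp_C,
    neg_smul, sub_eq_add_neg]

theorem circlePolyOp_mem (P : Polynomial ℂ) {f : L2Circle} (hf : f ∈ hardyDisk) :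
    circlePolyOp P f ∈ hardyDisk := by
  rw [mem_hardyDisk] at hf ⊢
  intro k hk
  rw [circleCoeff_circlePolyOp]
  refine Finset.sum_eq_zero fun a _ => ?_
  dsimp only
  rw [hf _ (by omega), mul_zero]

/-- The boundary function of a polynomial in one variable. -/
def circlePolyFn (P : Polynomial ℂ) : L2Circle := circlePolyOp P (circleChar 0)

theorem circlePolyOp_circlePolyFn (P Q : Polynomial ℂ) :
    circlePolyOp P (circlePolyFn Q) = circlePolyFn (P * Q) :=
  (circlePolyOp_mul _ _ _).symm

theorem coeFn_circlePolyFn (P : Polynomial ℂ) :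
    circlePolyFn P =ᵐ[circleMeasure] fun x => P.eval (circlePt x) := by
  filter_upwards [coeFn_mulOp _ (memLp_circle_eval P) (circleChar 0), coeFn_circleChar 0]
    with x h1 h2
  rw [circlePolyFn, circlePolyOp, h1, h2, fourier_zero, mul_one]

theorem circleCoeff_circlePolyFn (P : Polynomial ℂ) (a : ℕ) :
    circleCoeff a (circlePolyFn P) = P.coeff a := by
  rw [circlePolyFn, circleCoeff_circlePolyOp, Polynomial.sum]
  simp only [circleCoeff_circleChar, sub_eq_zero, Nat.cast_inj, mul_ite, mul_one, mul_zero,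
    Finset.sum_ite_eq]
  simp +contextual [eq_comm]

theorem circleCoeff_circlePolyFn_of_neg (P : Polynomial ℂ) {k : ℤ} (hk : k < 0) :
    circleCoeff k (circlePolyFn P) = 0 := by
  rw [circlePolyFn, circleCoeff_circlePolyOp]
  refine Finset.sum_eq_zero fun a _ => ?_
  dsimp only
  rw [circleCoeff_circleChar, if_neg (by omega), mul_zero]

theorem circlePolyFn_mem (P : Polynomial ℂ) : circlePolyFn P ∈ hardyDisk :=
  mem_hardyDisk.2 fun _ hk => circleCoeff_circlePolyFn_of_neg P hk

theorem circlePolyFn_injective : Function.Injective circlePolyFn := fun P Q h => by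
  ext a
  rw [← circleCoeff_circlePolyFn, h, circleCoeff_circlePolyFn]

theorem exists_circlePolyFn_eq {f : L2Circle} (hf : f ∈ hardyDisk) (N : ℤ)
    (h : ∀ k, N < k → circleCoeff k f = 0) : ∃ P : Polynomial ℂ, circlePolyFn P = f := by
  let P : Polynomial ℂ :=
    ∑ a ∈ Finset.range (N.toNat + 1), Polynomial.monomial a (circleCoeff a f)
  have hP : ∀ a : ℕ, P.coeff a = circleCoeff a f := by
    intro a
    simp only [P, Polynomial.finsetSum_coeff, Polynomial.coeff_monomial, Finset.sum_ite_eq',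
      Finset.mem_range]
    split_ifs with ha
    · rfl
    · exact (h a (by omega)).symm
  refine ⟨P, circle_ext fun k => ?_⟩
  by_cases hk : k < 0
  · rw [circleCoeff_circlePolyFn_of_neg P hk, mem_hardyDisk.1 hf k hk]
  · lift k to ℕ using not_lt.1 hk
    rw [circleCoeff_circlePolyFn, hP]

/-! ### Division by linear factors in `H²`, and rational functions without poles -/

theorem circleCoeff_circlePolyOp_X_sub_C (c : ℂ) (f : L2Circle) (k : ℤ) :
    circleCoeff k (circlePolyOp (Polynomial.X - Polynomial.C c) f) =
      circleCoeff (k - 1) f - c * circleCoeff k f := by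
  rw [circlePolyOp_X_sub_C, map_sub, map_smul, circleCoeff_circleCharOp, smul_eq_mul]

/-- Division by `z - β` with `|β| ≥ 1` preserves `H²`. -/
theorem mem_hardyDisk_of_X_sub_C {β : ℂ} (hβ : 1 ≤ ‖β‖) {g : L2Circle}
    (hg : circlePolyOp (Polynomial.X - Polynomial.C β) g ∈ hardyDisk) : g ∈ hardyDisk := by
  rw [mem_hardyDisk] at hg ⊢
  intro k hk
  -- At a negative index `l` the equation reads `g_{l-1} = β g_l`, so the moduli do not decrease
  -- towards `-∞`, yet they tend to zero.
  have hstep : ∀ l < 0, ‖circleCoeff l g‖ ≤ ‖circleCoeff (l - 1) g‖ := by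
    intro l hl
    have := hg l hl
    rw [circleCoeff_circlePolyOp_X_sub_C, sub_eq_zero] at this
    rw [this, norm_mul]
    exact le_mul_of_one_le_left (norm_nonneg _) hβ
  have hmono : ∀ n : ℕ, ‖circleCoeff k g‖ ≤ ‖circleCoeff (k - n) g‖ := by
    intro n
    induction n with
    | zero => simp
    | succ n ih =>
      refine ih.trans ((hstep _ (by omega)).trans_eq ?_)
      push_cast
      rw [sub_sub]
  have hinj : Function.Injective fun n : ℕ => k - (n : ℤ) := fun a b h => by simpa using h
  have ht := (tendsto_circleCoeff g).comp hinj.tendsto_cofinite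
  rw [Nat.cofinite_eq_atTop] at ht
  exact norm_le_zero_iff.1 (ge_of_tendsto' ht hmono)

/-- If `g ∈ H²` and `(z - c) g` is a polynomial, where `|c| ≤ 1`, then `g` is a polynomial. -/
theorem exists_circlePolyFn_of_X_sub_C {c : ℂ} (hc : ‖c‖ ≤ 1) {g : L2Circle}
    (hg : g ∈ hardyDisk) {A : Polynomial ℂ}
    (h : circlePolyOp (Polynomial.X - Polynomial.C c) g = circlePolyFn A) :
    ∃ P, circlePolyFn P = g := by
  have hA : ∀ l : ℤ, (A.natDegree : ℤ) < l → circleCoeff l (circlePolyFn A) = 0 := by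
    intro l hl
    lift l to ℕ using by omega
    rw [circleCoeff_circlePolyFn]
    exact Polynomial.coeff_eq_zero_of_natDegree_lt (by exact_mod_cast hl)
  refine exists_circlePolyFn_eq hg A.natDegree fun k hk => ?_
  -- Beyond the degree of `A` the equation reads `g_l = c g_{l+1}`, so the moduli do not decrease
  -- towards `+∞`, yet they tend to zero.
  have hstep : ∀ l, (A.natDegree : ℤ) < l → ‖circleCoeff l g‖ ≤ ‖circleCoeff (l + 1) g‖ := by
    intro l hl
    have h1 := circleCoeff_circlePolyOp_X_sub_C c g (l + 1)
    rw [h, hA _ (by omega), eq_comm, sub_eq_zero, add_sub_cancel_right] at h1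
    rw [h1, norm_mul]
    exact mul_le_of_le_one_left (norm_nonneg _) hc
  have hmono : ∀ n : ℕ, ‖circleCoeff k g‖ ≤ ‖circleCoeff (k + n) g‖ := by
    intro n
    induction n with
    | zero => simp
    | succ n ih =>
      refine ih.trans ((hstep _ (by omega)).trans_eq ?_)
      push_cast
      rw [add_assoc]
  have hinj : Function.Injective fun n : ℕ => k + (n : ℤ) := fun a b h => by simpa using h
  have ht := (tendsto_circleCoeff g).comp hinj.tendsto_cofinite
  rw [Nat.cofinite_eq_atTop] at ht
  exact norm_le_zero_iff.1 (ge_of_tendsto' ht hmono)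

/-- Division by a polynomial without zeros in the open disk preserves `H²`. -/
theorem mem_hardyDisk_of_circlePolyOp {P : Polynomial ℂ} (hP : ∀ z, ‖z‖ < 1 → P.eval z ≠ 0)
    {g : L2Circle} (hg : circlePolyOp P g ∈ hardyDisk) : g ∈ hardyDisk := by
  obtain ⟨d, hd⟩ : ∃ d, P.natDegree = d := ⟨_, rfl⟩
  induction d generalizing P with
  | zero =>
    rw [Polynomial.eq_C_of_natDegree_eq_zero hd, circlePolyOp_C] at hg
    have h0 : P.coeff 0 ≠ 0 := by simpa [Polynomial.coeff_zero_eq_eval_zero] using hP 0 (by simp)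
    exact (hardyDisk.smul_mem_iff h0).1 hg
  | succ d ih =>
    -- Linear factors are divided out one at a time; every root has modulus at least `1`.
    obtain ⟨β, hβ⟩ := IsAlgClosed.exists_root P (fun h0 => by
      have := Polynomial.natDegree_eq_of_degree_eq_some (n := 0) (by simpa using h0)
      omega)
    obtain ⟨Q, rfl⟩ := Polynomial.dvd_iff_isRoot.2 hβ
    have hβ1 : 1 ≤ ‖β‖ := by
      by_contra! hc
      exact hP β hc hβ
    have hQ0 : Q ≠ 0 := by rintro rfl; simp at hd
    rw [Polynomial.natDegree_mul (Polynomial.X_sub_C_ne_zero β) hQ0,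
      Polynomial.natDegree_X_sub_C] at hd
    rw [circlePolyOp_mul] at hg
    refine ih (fun z hz h0 => hP z hz ?_) (mem_hardyDisk_of_X_sub_C hβ1 hg) (by omega)
    rw [Polynomial.eval_mul, h0, mul_zero]

/-- A function in `H²` that satisfies a linear equation `D f = A` with polynomials `D ≠ 0` and `A`
is a rational function without poles in the closed disk. -/
theorem exists_eq_div_of_mem_hardyDisk {D A : Polynomial ℂ} (hD : D ≠ 0) {f : L2Circle}
    (hf : f ∈ hardyDisk) (h : circlePolyOp D f = circlePolyFn A) :
    ∃ a b : Polynomial ℂ, (∀ z : ℂ, ‖z‖ ≤ 1 → b.eval z ≠ 0) ∧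
      circlePolyOp b f = circlePolyFn a := by
  obtain ⟨d, hd⟩ : ∃ d, D.natDegree = d := ⟨_, rfl⟩
  induction d generalizing D A with
  | zero =>
    refine ⟨A, D, fun z _ h0 => hD ?_, h⟩
    rw [Polynomial.eq_C_of_natDegree_eq_zero hd] at h0 ⊢
    rw [Polynomial.eval_C] at h0
    rw [h0, Polynomial.C_0]
  | succ d ih =>
    -- A root in the closed disk, boundary included, cancels because `Q f` lies in `H²` and is
    -- therefore a polynomial. When only roots outside remain, `D` is an admissible denominator.
    by_cases hroot : ∃ z : ℂ, ‖z‖ ≤ 1 ∧ D.eval z = 0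
    · obtain ⟨c, hc, hr⟩ := hroot
      obtain ⟨Q, rfl⟩ := Polynomial.dvd_iff_isRoot.2 hr
      have hQ0 : Q ≠ 0 := by rintro rfl; simp at hd
      rw [Polynomial.natDegree_mul (Polynomial.X_sub_C_ne_zero c) hQ0,
        Polynomial.natDegree_X_sub_C] at hd
      rw [circlePolyOp_mul] at h
      obtain ⟨B, hB⟩ := exists_circlePolyFn_of_X_sub_C hc (circlePolyOp_mem Q hf) h
      exact ih hQ0 hB.symm (by omega)
    · push Not at hroot
      exact ⟨A, D, hroot, h⟩

/-! ### Boundary values of rational inner functions -/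

theorem circlePt_ne_zero (u : UnitAddCircle) : circlePt u ≠ 0 := Circle.coe_ne_zero _

theorem conj_circlePt (u : UnitAddCircle) : conj (circlePt u) = (circlePt u)⁻¹ :=
  (Complex.inv_eq_conj (norm_circlePt u)).symm

theorem circlePt_injective : Function.Injective circlePt := fun _ _ h =>
  AddCircle.injective_toCircle one_ne_zero (Subtype.coe_injective h)

/-- Finite sets are null, so a nonzero polynomial vanishes almost nowhere on the circle. The circle
is nontrivial because `0` and `1/2` are sent to `1` and `-1`. -/
instance : NullSingletonClass circleMeasure := by
  have : Nontrivial UnitAddCircle := ⟨⟨0, ((1 / 2 : ℝ) : UnitAddCircle), fun h => by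
    have h2 := congrArg circlePt h.symm
    rw [circlePt, circlePt, AddCircle.toCircle_zero] at h2
    rw [AddCircle.toCircle_apply_mk, Circle.coe_exp] at h2
    have h3 : (((2 * Real.pi / 1 * (1 / 2) : ℝ) : ℂ) * Complex.I) = Real.pi * Complex.I := by
      push_cast; ring
    rw [h3, Complex.exp_pi_mul_I] at h2
    norm_num at h2⟩⟩
  infer_instance

theorem ae_circle_eval_ne_zero {P : Polynomial ℂ} (hP : P ≠ 0) :
    ∀ᵐ u ∂circleMeasure, P.eval (circlePt u) ≠ 0 := by
  have hfin : {u | P.eval (circlePt u) = 0}.Finite := by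
    have h1 : {z : ℂ | P.eval z = 0}.Finite := by
      simpa [Polynomial.IsRoot] using Polynomial.finite_setOfPred_isRoot hP
    exact h1.preimage circlePt_injective.injOn
  rw [ae_iff]
  simpa using hfin.measure_zero circleMeasure

/-- The reflection of a polynomial on the unit circle is again a polynomial. -/
theorem exists_eval_eq_pow_mul_conj {P : Polynomial ℂ} {N : ℕ} (hP : P.natDegree ≤ N) :
    ∃ R : Polynomial ℂ, ∀ u : UnitAddCircle,
      R.eval (circlePt u) = circlePt u ^ N * conj (P.eval (circlePt u)) := by
  refine ⟨∑ a ∈ Finset.range (N + 1), Polynomial.C (conj (P.coeff a)) * Polynomial.X ^ (N - a),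
    fun u => ?_⟩
  rw [Polynomial.eval_eq_sum_range' (Nat.lt_succ_of_le hP), map_sum, Finset.mul_sum,
    Polynomial.eval_finsetSum]
  refine Finset.sum_congr rfl fun a ha => ?_
  have ha' : a ≤ N := by simpa [Nat.lt_succ_iff] using ha
  simp only [Polynomial.eval_mul, Polynomial.eval_C, Polynomial.eval_pow, Polynomial.eval_X,
    map_mul, map_pow, conj_circlePt, pow_sub₀ _ (circlePt_ne_zero u) ha', inv_pow]
  ring

/-- The convention `0 / 0 = 0` makes the bound valid at zeros too, so no exceptional set is needed.
-/
theorem norm_conj_div_le (w : ℂ) : ‖conj w / w‖ ≤ 1 := by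
  rw [norm_div, RCLike.norm_conj]
  exact div_self_le_one _

/-- The quotient of the reflection of a polynomial without zeros in the disk by the polynomial
has no Fourier coefficients of negative index. -/
theorem integral_circle_conj_div_eq_zero {P : Polynomial ℂ} {N : ℕ} (hN : P.natDegree ≤ N)
    (hP : ∀ z, ‖z‖ < 1 → P.eval z ≠ 0) {k : ℤ} (hk : k < 0) :
    ∫ u, fourier (-k) u * (circlePt u ^ N * (conj (P.eval (circlePt u)) / P.eval (circlePt u)))
      ∂circleMeasure = 0 := by
  let φ : UnitAddCircle → ℂ := fun u =>
    circlePt u ^ N * (conj (P.eval (circlePt u)) / P.eval (circlePt u))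
  have hφ : MemLp φ 2 circleMeasure := by
    refine MemLp.of_bound (C := 1) ?_ (.of_forall fun u => ?_)
    · have h1 := (continuous_eval_circlePt P).measurable
      exact ((continuous_circlePt.measurable.pow_const N).mul
        ((Complex.continuous_conj.measurable.comp h1).div h1)).aestronglyMeasurable
    · rw [norm_mul, norm_pow, norm_circlePt, one_pow, one_mul]
      exact norm_conj_div_le _
  obtain ⟨R, hR⟩ := exists_eval_eq_pow_mul_conj hN
  -- Multiplication by `P` turns `φ` into the reflected polynomial, which is in `H²`; division by
  -- `P` stays in `H²`.
  have hg : circlePolyOp P (hφ.toLp φ) = circlePolyFn R := by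
    refine mulOp_eq_of_ae _ ?_
    filter_upwards [hφ.coeFn_toLp, coeFn_circlePolyFn R] with u h1 h2
    rw [h1, h2, hR]
    by_cases h0 : P.eval (circlePt u) = 0
    · simp [h0]
    · simp only [φ]
      field_simp
  have hmem := mem_hardyDisk_of_circlePolyOp hP (hg ▸ circlePolyFn_mem R)
  have h0 : fourierCoeff (hφ.toLp φ) k = 0 := hmem k hk
  rw [← h0, fourierCoeff]
  refine integral_congr_ae ?_
  filter_upwards [hφ.coeFn_toLp] with u h1
  rw [h1, smul_eq_mul]

/-! ### Slices of polynomials and of functions on the torus -/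

/-- The polynomial in the variable `z i` obtained by giving the other variable the value `w`. -/
def slicePoly (i : Fin 2) (w : ℂ) (p : MvPolynomial (Fin 2) ℂ) : Polynomial ℂ :=
  aeval (fun l => if l = i then Polynomial.X else Polynomial.C w) p

theorem eval_slicePoly (i : Fin 2) (w z : ℂ) (p : MvPolynomial (Fin 2) ℂ) :
    (slicePoly i w p).eval z = eval (fun l => if l = i then z else w) p := by
  rw [slicePoly, ← Polynomial.coe_evalRingHom, MvPolynomial.map_aeval, coe_eval₂Hom,
    ← MvPolynomial.coe_eval₂Hom]
  have : ((Polynomial.evalRingHom z).comp (algebraMap ℂ (Polynomial ℂ))) = RingHom.id ℂ := by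
    ext x; simp
  rw [this]
  simp only [eval, coe_eval₂Hom]
  congr 1
  funext l
  split_ifs <;> simp

theorem natDegree_slicePoly_le (i : Fin 2) (w : ℂ) (p : MvPolynomial (Fin 2) ℂ) :
    (slicePoly i w p).natDegree ≤ p.degreeOf i := by
  rw [slicePoly, aeval_def, eval₂_eq]
  refine Polynomial.natDegree_sum_le_of_forall_le _ _ fun a ha => ?_
  refine (Polynomial.natDegree_C_mul_le _ _).trans ?_
  refine (Polynomial.natDegree_prod_le _ _).trans ?_
  refine le_trans ?_ (monomial_le_degreeOf i ha)
  refine (Finset.sum_le_sum (g := fun l => if l = i then a i else 0) fun l _ => ?_).trans ?_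
  · split_ifs with h
    · subst h; simp
    · rw [← Polynomial.C_pow, Polynomial.natDegree_C]
  · simp only [Finset.sum_ite_eq']
    split_ifs <;> simp

theorem torusPt_insertNth (i : Fin 2) (u w : UnitAddCircle) :
    torusPt (i.insertNth u fun _ => w) = fun l => if l = i then circlePt u else circlePt w := by
  funext l
  rw [torusPt]
  obtain rfl | ⟨j, rfl⟩ := i.eq_self_or_eq_succAbove l
  · simp
  · simp [Fin.succAbove_ne]

/-- Fubini; if `F` is not integrable, its integral is `0` by definition. -/
theorem integral_torus_eq_zero_of_slice (i : Fin 2) {F : UnitAddTorus (Fin 2) → ℂ}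
    (h : ∀ w : UnitAddCircle, ∫ u, F (i.insertNth u fun _ => w) ∂circleMeasure = 0) :
    ∫ x, F x ∂torusMeasure = 0 := by
  by_cases hF : Integrable F torusMeasure
  · have hmp := (measurePreserving_piFinSuccAbove (fun _ : Fin 2 => circleMeasure) i).symm
    have he : MeasurableEmbedding
        (MeasurableEquiv.piFinSuccAbove (fun _ : Fin 2 => UnitAddCircle) i).symm :=
      MeasurableEquiv.measurableEmbedding _
    rw [← hmp.integral_comp he, integral_prod_symm]
    · refine (integral_congr_ae (.of_forall fun y => ?_)).trans (integral_zero _ _)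
      rw [← h (y 0)]
      refine integral_congr_ae (.of_forall fun u => ?_)
      rw [MeasurableEquiv.piFinSuccAbove_symm_apply]
      dsimp only
      congr 1
      simp only [Fin.insertNthEquiv, Equiv.coe_fn_mk]
      congr 1
      funext j
      rw [Subsingleton.elim j 0]
    · exact (hmp.integrable_comp_emb he).2 hF
  · exact integral_undef hF

/-! ### Boundary zeros of `p` and Fourier support of `Θ` -/

namespace IsInnerDenominator

variable {m n : ℕ} {p : MvPolynomial (Fin 2) ℂ}

/-- Since `p(0,0) ≠ 0`, the polynomial `p(·,0)` is nonzero, so `p(u,0) ≠ 0` for almost every `u` on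
the circle. For such `u` the slice `p(u,·)` is a nonzero polynomial, and Fubini concludes. -/
theorem ae_ne_zero (hp : IsInnerDenominator m n p) :
    ∀ᵐ x ∂torusMeasure, eval (torusPt x) p ≠ 0 := by
  have hmp := (measurePreserving_piFinSuccAbove (fun _ : Fin 2 => circleMeasure) 0)
  have key : ∀ᵐ z ∂(circleMeasure.prod (Measure.pi fun _ : Fin 1 => circleMeasure)),
      eval (torusPt ((0 : Fin 2).insertNth z.1 z.2)) p ≠ 0 := by
    rw [Measure.ae_prod_iff_ae_ae]
    · have h0 : slicePoly 0 0 p ≠ 0 := by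
        intro h
        have := eval_slicePoly 0 0 0 p
        rw [h, Polynomial.eval_zero] at this
        exact hp.ne_zero _ (fun i => by split_ifs <;> simp) this.symm
      filter_upwards [ae_circle_eval_ne_zero h0] with u hu
      have h1 : slicePoly 1 (circlePt u) p ≠ 0 := by
        intro h
        have := eval_slicePoly 1 (circlePt u) 0 p
        rw [h, Polynomial.eval_zero] at this
        rw [eval_slicePoly] at hu
        refine hu (Eq.trans ?_ this.symm)
        congr 2
        funext l
        fin_cases l <;> simp
      have h2 := ae_circle_eval_ne_zero h1
      have hev := (measurePreserving_eval (fun _ : Fin 1 => circleMeasure) 0).quasiMeasurePreserving.ae h2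
      filter_upwards [hev] with y hy
      rw [Function.eval, eval_slicePoly] at hy
      have hy' : y = fun _ => y 0 := funext fun j => by rw [Subsingleton.elim j 0]
      rw [hy', torusPt_insertNth]
      convert hy using 4 with l
      fin_cases l <;> simp
    · refine (MeasurableSet.compl ?_)
      refine measurableSet_eq_fun ?_ measurable_const
      refine (continuous_eval_torusPt p).measurable.comp ?_
      have := (MeasurableEquiv.piFinSuccAbove (fun _ : Fin 2 => UnitAddCircle) 0).symm.measurable
      rw [MeasurableEquiv.piFinSuccAbove_symm_apply] at this
      exact this
  have := hmp.quasiMeasurePreserving.ae key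
  filter_upwards [this] with x hx
  have hx2 : (0 : Fin 2).insertNth
      (MeasurableEquiv.piFinSuccAbove (fun _ : Fin 2 => UnitAddCircle) 0 x).1
      (MeasurableEquiv.piFinSuccAbove (fun _ : Fin 2 => UnitAddCircle) 0 x).2 = x :=
    (MeasurableEquiv.piFinSuccAbove (fun _ : Fin 2 => UnitAddCircle) 0).symm_apply_apply x
  rwa [hx2] at hx

theorem rationalInner_eq (hp : IsInnerDenominator m n p) (x : UnitAddTorus (Fin 2)) :
    rationalInner m n p (torusPt x) = torusPt x 0 ^ m * torusPt x 1 ^ n *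
      (conj (eval (torusPt x) p) / eval (torusPt x) p) := by
  have hz : ∀ i, torusPt x i ≠ 0 := fun i => circlePt_ne_zero _
  have hconj : (fun i => 1 / conj (torusPt x i)) = torusPt x := by
    funext i
    rw [torusPt, conj_circlePt, one_div, inv_inv]
  rw [rationalInner, eval_reflection hp.degree_fst hp.degree_snd _ (hz 0) (hz 1), hconj,
    mul_div_assoc]

theorem degreeOf_le (hp : IsInnerDenominator m n p) (i : Fin 2) :
    p.degreeOf i ≤ (![m, n] : Fin 2 → ℕ) i := by
  fin_cases i
  · exact hp.degree_fst
  · exact hp.degree_snd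

/-- The Fourier coefficients of a rational inner function vanish outside `ℕ²`. -/
theorem integral_rationalInner_eq_zero (hp : IsInnerDenominator m n p) {k : Fin 2 → ℤ}
    (hk : ∃ i, k i < 0) :
    ∫ x, UnitAddTorus.mFourier (-k) x * rationalInner m n p (torusPt x) ∂torusMeasure = 0 := by
  obtain ⟨i, hi⟩ := hk
  let N : Fin 2 → ℕ := ![m, n]
  -- Only the other variable is dilated, by `s < 1`. The slice in `z_i` then has no zeros in the
  -- open disk, although `p` may vanish on the torus, and the one-variable result applies; finally
  -- `s → 1`.
  let pt : ℝ → UnitAddTorus (Fin 2) → Fin 2 → ℂ := fun s x l =>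
    if l = i then torusPt x l else s * torusPt x l
  let F : ℝ → UnitAddTorus (Fin 2) → ℂ := fun s x => UnitAddTorus.mFourier (-k) x *
    ((∏ l, torusPt x l ^ N l) * (conj (eval (pt s x) p) / eval (pt s x) p))
  let s : ℕ → ℝ := fun j => 1 - 1 / ((j : ℝ) + 1)
  have hs0 : ∀ j, 0 ≤ s j := fun j => by
    have : (1 : ℝ) / ((j : ℝ) + 1) ≤ 1 := by
      rw [div_le_one (by positivity)]; linarith [Nat.cast_nonneg (α := ℝ) j]
    simp only [s]; linarith
  have hs1 : ∀ j, s j < 1 := fun j => by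
    have : (0 : ℝ) < 1 / ((j : ℝ) + 1) := by positivity
    simp only [s]; linarith
  have hslim : Filter.Tendsto s Filter.atTop (nhds 1) := by
    simpa [s] using (tendsto_const_nhds (x := (1 : ℝ))).sub
      (tendsto_one_div_add_atTop_nhds_zero_nat (𝕜 := ℝ))
  have hptc : ∀ s, Continuous (pt s) := fun s => continuous_pi fun l => by
    have h0 : Continuous fun x => torusPt x l := (continuous_apply l).comp continuous_torusPt
    by_cases h : l = i
    · simpa only [pt, if_pos h] using h0
    · have h1 : Continuous fun x => (s : ℂ) * torusPt x l := continuous_const.mul h0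
      simpa only [pt, if_neg h] using h1
  have hFs : ∀ j, ∫ x, F (s j) x ∂torusMeasure = 0 := by
    intro j
    refine integral_torus_eq_zero_of_slice i fun w => ?_
    let P := slicePoly i (s j * circlePt w) p
    have hPz : ∀ z, ‖z‖ < 1 → P.eval z ≠ 0 := by
      intro z hz
      rw [eval_slicePoly]
      refine hp.ne_zero _ fun l => ?_
      split_ifs
      · exact hz
      · rw [norm_mul, norm_circlePt, mul_one, Complex.norm_real, Real.norm_of_nonneg (hs0 j)]
        exact hs1 j
    have h1 := integral_circle_conj_div_eq_zero (P := P)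
      ((natDegree_slicePoly_le i _ p).trans (hp.degreeOf_le i)) hPz hi
    rw [← mul_zero (fourier (-k (i.succAbove 0)) w * circlePt w ^ N (i.succAbove 0)), ← h1,
      ← integral_const_mul]
    refine integral_congr_ae (.of_forall fun u => ?_)
    have hpt : eval (pt (s j) (i.insertNth u fun _ => w)) p = P.eval (circlePt u) := by
      rw [eval_slicePoly]
      congr 2
      funext l
      simp only [pt, torusPt_insertNth]
      split_ifs <;> rfl
    simp only [F, hpt, UnitAddTorus.mFourier, ContinuousMap.coe_mk, torusPt,
      Fin.prod_univ_succAbove _ i, Fin.insertNth_apply_same, Fin.insertNth_apply_succAbove,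
      Finset.univ_unique, Finset.prod_singleton, Pi.neg_apply]
    rw [show (default : Fin 1) = 0 from rfl]
    ring
  have hlim : Filter.Tendsto (fun j => ∫ x, F (s j) x ∂torusMeasure) Filter.atTop
      (nhds (∫ x, UnitAddTorus.mFourier (-k) x * rationalInner m n p (torusPt x)
        ∂torusMeasure)) := by
    -- The integrands are bounded by `1` and converge wherever `p` does not vanish, hence almost
    -- everywhere.
    refine tendsto_integral_of_dominated_convergence (fun _ => 1) (fun j => ?_)
      (integrable_const _) (fun j => .of_forall fun x => ?_) ?_
    · have h1 : Measurable fun x => eval (pt (s j) x) p :=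
        ((MvPolynomial.continuous_eval p).comp (hptc _)).measurable
      have h2 : Continuous fun x : UnitAddTorus (Fin 2) => ∏ l, torusPt x l ^ N l :=
        continuous_finsetProd _ fun l _ =>
          ((continuous_apply l).comp continuous_torusPt).pow _
      exact ((UnitAddTorus.mFourier (-k)).continuous.measurable.mul (h2.measurable.mul
        ((Complex.continuous_conj.measurable.comp h1).div h1))).aestronglyMeasurable
    · simp only [F, norm_mul, norm_prod, norm_pow, torusPt, norm_circlePt, one_pow,
        Finset.prod_const_one, one_mul]
      refine mul_le_one₀ (((UnitAddTorus.mFourier (-k)).norm_coe_le_norm x).trans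
        UnitAddTorus.mFourier_norm.le) (norm_nonneg _) (norm_conj_div_le _)
    · filter_upwards [hp.ae_ne_zero] with x hx
      have hpl : Filter.Tendsto (fun j => eval (pt (s j) x) p) Filter.atTop
          (nhds (eval (torusPt x) p)) := by
        have : Filter.Tendsto (fun j => pt (s j) x) Filter.atTop (nhds (torusPt x)) := by
          rw [tendsto_pi_nhds]
          intro l
          by_cases h : l = i
          · simp [pt, h]
          · have h3 := ((Complex.continuous_ofReal.tendsto 1).comp hslim).mul_const (torusPt x l)
            simpa [pt, h] using h3
        exact ((MvPolynomial.continuous_eval p).tendsto _).comp this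
      rw [hp.rationalInner_eq]
      have := (((Complex.continuous_conj.tendsto _).comp hpl).div hpl hx).const_mul
        (torusPt x 0 ^ m * torusPt x 1 ^ n) |>.const_mul (UnitAddTorus.mFourier (-k) x)
      simpa [F, N, Fin.prod_univ_two] using this
  simp only [hFs] at hlim
  exact (tendsto_nhds_unique tendsto_const_nhds hlim).symm

end IsInnerDenominator

/-! ### The Hardy space of the bidisk -/

theorem isClosed_hardyBidisk : IsClosed (hardyBidisk : Set L2Torus) := by
  have : (hardyBidisk : Set L2Torus) =
      ⋂ k : Fin 2 → ℤ, ⋂ _ : ∃ i, k i < 0, {f | torusCoeff k f = 0} := by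
    ext f
    simp only [Set.mem_iInter, SetLike.mem_coe, mem_hardyBidisk]
    rfl
  rw [this]
  exact isClosed_iInter fun k => isClosed_iInter fun _ =>
    isClosed_eq (torusCoeff k).continuous continuous_const

instance : CompleteSpace hardyBidisk := isClosed_hardyBidisk.completeSpace_coe

theorem torusChar_mem {k : Fin 2 → ℤ} (hk : ¬ ∃ i, k i < 0) : torusChar k ∈ hardyBidisk := by
  rw [mem_hardyBidisk]
  intro l hl
  rw [torusCoeff_torusChar, if_neg]
  rintro rfl
  exact hk hl

/-- The orthogonal projection of `L²` of the torus onto `H²`. -/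
def hardyProj : L2Torus →L[ℂ] L2Torus := hardyBidisk.starProjection

theorem hardyProj_mem (f : L2Torus) : hardyProj f ∈ hardyBidisk :=
  hardyBidisk.starProjection_apply_mem f

theorem inner_hardyProj {h : L2Torus} (hh : h ∈ hardyBidisk) (f : L2Torus) :
    ⟪h, hardyProj f⟫_ℂ = ⟪h, f⟫_ℂ := by
  have := Submodule.starProjection_inner_eq_zero (K := hardyBidisk) f h hh
  rw [inner_sub_left, sub_eq_zero] at this
  rw [← inner_conj_symm, hardyProj, ← this, inner_conj_symm]

theorem torusCoeff_hardyProj {k : Fin 2 → ℤ} (hk : ¬ ∃ i, k i < 0) (f : L2Torus) :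
    torusCoeff k (hardyProj f) = torusCoeff k f :=
  inner_hardyProj (torusChar_mem hk) f

theorem torusCoeff_hardyProj_of_neg {k : Fin 2 → ℤ} (hk : ∃ i, k i < 0) (f : L2Torus) :
    torusCoeff k (hardyProj f) = 0 :=
  mem_hardyBidisk.1 (hardyProj_mem f) k hk

/-- Multiplication by `z_i ^ l`. -/
def shift (i : Fin 2) (l : ℤ) : L2Torus →L[ℂ] L2Torus := charOp (Pi.single i l)

theorem shift_zero (i : Fin 2) (f : L2Torus) : shift i 0 f = f := by
  rw [shift, Pi.single_zero, charOp_zero]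

theorem shift_shift (i : Fin 2) (a b : ℤ) (f : L2Torus) :
    shift i a (shift i b f) = shift i (a + b) f := by
  rw [shift, shift, shift, charOp_charOp, Pi.single_add]

theorem shift_comm (i j : Fin 2) (a b : ℤ) (f : L2Torus) :
    shift i a (shift j b f) = shift j b (shift i a f) := by
  rw [shift, shift, charOp_charOp, charOp_charOp, add_comm]

theorem inner_shift_left (i : Fin 2) (a : ℤ) (f g : L2Torus) :
    ⟪shift i a f, g⟫_ℂ = ⟪f, shift i (-a) g⟫_ℂ := by
  rw [shift, inner_charOp_left, shift, Pi.single_neg]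

theorem inner_shift_right (i : Fin 2) (a : ℤ) (f g : L2Torus) :
    ⟪f, shift i a g⟫_ℂ = ⟪shift i (-a) f, g⟫_ℂ := by
  rw [inner_shift_left, neg_neg]

theorem coordMul_eq_shift (i : Fin 2) : coordMul i = shift i 1 := coordMul_eq i

theorem torusCoeff_shift (i : Fin 2) (a : ℤ) (k : Fin 2 → ℤ) (f : L2Torus) :
    torusCoeff k (shift i a f) = torusCoeff (k - Pi.single i a) f :=
  torusCoeff_charOp _ _ _

theorem polyOp_shift (q : MvPolynomial (Fin 2) ℂ) (i : Fin 2) (a : ℤ) (f : L2Torus) :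
    polyOp q (shift i a f) = shift i a (polyOp q f) :=
  polyOp_charOp _ _ _

theorem shift_mem (i : Fin 2) (a : ℕ) {f : L2Torus} (hf : f ∈ hardyBidisk) :
    shift i a f ∈ hardyBidisk := by
  rw [mem_hardyBidisk] at hf ⊢
  rintro k ⟨j, hj⟩
  rw [torusCoeff_shift]
  refine hf _ ⟨j, ?_⟩
  rw [Pi.sub_apply, Pi.single_apply]
  split_ifs <;> omega

/-- The backward shift on `H²` in the variable `z_i`. -/
def backShift (i : Fin 2) : L2Torus →L[ℂ] L2Torus := hardyProj ∘L shift i (-1)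

theorem backShift_mem (i : Fin 2) (f : L2Torus) : backShift i f ∈ hardyBidisk := hardyProj_mem _

theorem inner_backShift (i : Fin 2) {h : L2Torus} (hh : h ∈ hardyBidisk) (f : L2Torus) :
    ⟪h, backShift i f⟫_ℂ = ⟪shift i 1 h, f⟫_ℂ := by
  rw [backShift, ContinuousLinearMap.comp_apply, inner_hardyProj hh, inner_shift_left]

/-- For `f ∈ H²`, the coefficients of `f - z_i B_i f` vanish unless the `i`-th index is zero. -/
theorem torusCoeff_sub_shift_backShift (i : Fin 2) {f : L2Torus} (hf : f ∈ hardyBidisk)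
    {k : Fin 2 → ℤ} (hk : k i ≠ 0) : torusCoeff k (f - shift i 1 (backShift i f)) = 0 := by
  rw [map_sub, torusCoeff_shift, sub_eq_zero]
  by_cases hk' : ∃ j, (k - Pi.single i 1 : Fin 2 → ℤ) j < 0
  · rw [backShift, ContinuousLinearMap.comp_apply, torusCoeff_hardyProj_of_neg hk']
    refine mem_hardyBidisk.1 hf k ?_
    obtain ⟨j, hj⟩ := hk'
    refine ⟨j, ?_⟩
    rw [Pi.sub_apply, Pi.single_apply] at hj
    split_ifs at hj with h
    · subst h; omega
    · omega
  · rw [backShift, ContinuousLinearMap.comp_apply, torusCoeff_hardyProj hk', torusCoeff_shift,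
      Pi.single_neg, sub_neg_eq_add, sub_add_cancel]

/-! ### Reflection of polynomials -/

theorem reflection_eq_sum (m n : ℕ) (p : MvPolynomial (Fin 2) ℂ) :
    reflection m n p = ∑ k ∈ p.support,
      monomial (Finsupp.single 0 (m - k 0) + Finsupp.single 1 (n - k 1)) (conj (p.coeff k)) := by
  rw [reflection]
  refine Finset.sum_congr rfl fun k _ => ?_
  rw [X_pow_eq_monomial, X_pow_eq_monomial, C_mul_monomial, monomial_mul, mul_one, mul_one]

theorem degreeOf_reflection_le (m n : ℕ) (p : MvPolynomial (Fin 2) ℂ) (i : Fin 2) :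
    (reflection m n p).degreeOf i ≤ (![m, n] : Fin 2 → ℕ) i := by
  classical
  rw [degreeOf_le_iff]
  intro a ha
  rw [reflection_eq_sum] at ha
  obtain ⟨k, _, hk⟩ := Finset.mem_biUnion.1 (support_sum ha)
  have := Finset.mem_singleton.1 (support_monomial_subset hk)
  subst this
  fin_cases i <;> simp

/-- The coefficient of `z₁^m z₂^n` in `p̃` is `conj p(0,0)`, which is nonzero. So `p̃` has full
degree even if `p` does not. -/
theorem le_degreeOf_reflection {m n : ℕ} {p : MvPolynomial (Fin 2) ℂ}
    (hp : IsInnerDenominator m n p) : m ≤ (reflection m n p).degreeOf 0 := by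
  have h0 : p.coeff 0 ≠ 0 := by
    have := hp.ne_zero 0 (by simp)
    rwa [← constantCoeff_eq, ← MvPolynomial.eval_zero]
  have hc : (reflection m n p).coeff (Finsupp.single 0 m + Finsupp.single 1 n) ≠ 0 := by
    rw [reflection_eq_sum, coeff_sum, Finset.sum_eq_single 0]
    · simpa using h0
    · intro k hk hk0
      rw [coeff_monomial, if_neg]
      intro h
      refine hk0 (Finsupp.ext fun i => ?_)
      have e0 : k 0 ≤ m := (monomial_le_degreeOf 0 hk).trans hp.degree_fst
      have e1 : k 1 ≤ n := (monomial_le_degreeOf 1 hk).trans hp.degree_snd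
      have h2 := DFunLike.congr_fun h 0
      have h3 := DFunLike.congr_fun h 1
      simp at h2 h3
      fin_cases i
      · simp; omega
      · simp; omega
    · intro h
      exact absurd (mem_support_iff.2 h0) h
  simpa using monomial_le_degreeOf 0 (mem_support_iff.2 hc)

/-! ### Multiplication by a rational inner function -/

namespace IsInnerDenominator

variable {m n : ℕ} {p : MvPolynomial (Fin 2) ℂ}

/-- Multiplication by `Θ = p̃ / p`. -/
def innerOp (hp : IsInnerDenominator m n p) : L2Torus →L[ℂ] L2Torus := mulOp _ hp.memLp

/-- Multiplication by the complex conjugate of `Θ = p̃ / p`. -/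
def innerOpAdj (hp : IsInnerDenominator m n p) : L2Torus →L[ℂ] L2Torus :=
  mulOp _ (memLp_conj hp.memLp)

theorem inner_innerOp_left (hp : IsInnerDenominator m n p) (f g : L2Torus) :
    ⟪hp.innerOp f, g⟫_ℂ = ⟪f, hp.innerOpAdj g⟫_ℂ :=
  inner_mulOp_left _ _ _

theorem inner_innerOpAdj_left (hp : IsInnerDenominator m n p) (f g : L2Torus) :
    ⟪hp.innerOpAdj f, g⟫_ℂ = ⟪f, hp.innerOp g⟫_ℂ := by
  rw [← inner_conj_symm, ← inner_innerOp_left, inner_conj_symm]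

theorem rationalInner_mul_conj (hp : IsInnerDenominator m n p) :
    ∀ᵐ x ∂torusMeasure,
      conj (rationalInner m n p (torusPt x)) * rationalInner m n p (torusPt x) = 1 := by
  filter_upwards [hp.ae_ne_zero] with x hx
  have h0 : ‖eval (torusPt x) p‖ ≠ 0 := norm_ne_zero_iff.2 hx
  rw [← Complex.normSq_eq_conj_mul_self, Complex.normSq_eq_norm_sq, hp.rationalInner_eq]
  simp only [norm_mul, norm_pow, norm_div, RCLike.norm_conj, torusPt, norm_circlePt, one_pow,
    one_mul]
  rw [div_self h0]
  norm_num

theorem innerOpAdj_innerOp (hp : IsInnerDenominator m n p) (f : L2Torus) :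
    hp.innerOpAdj (hp.innerOp f) = f := by
  refine mulOp_eq_of_ae _ ?_
  filter_upwards [coeFn_mulOp _ hp.memLp f, hp.rationalInner_mul_conj] with x h1 h2
  rw [innerOp, h1, ← mul_assoc, h2, one_mul]

theorem innerOp_innerOpAdj (hp : IsInnerDenominator m n p) (f : L2Torus) :
    hp.innerOp (hp.innerOpAdj f) = f := by
  rw [innerOp, innerOpAdj, mulOp_comm]
  exact hp.innerOpAdj_innerOp f

theorem polyOp_innerOp (hp : IsInnerDenominator m n p) (f : L2Torus) :
    polyOp p (hp.innerOp f) = polyOp (reflection m n p) f := by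
  refine mulOp_mulOp _ _ _ ?_ f
  filter_upwards [hp.ae_ne_zero] with x hx
  rw [rationalInner, mul_div_cancel₀ _ hx]

/-- The bridge between analysis and algebra: knowledge of the Fourier support of `conj Θ f` turns
into a degree bound on `p f`. -/
theorem polyOp_reflection_innerOpAdj (hp : IsInnerDenominator m n p) (f : L2Torus) :
    polyOp (reflection m n p) (hp.innerOpAdj f) = polyOp p f := by
  rw [← hp.polyOp_innerOp, hp.innerOp_innerOpAdj]

theorem polyOp_injective (hp : IsInnerDenominator m n p) : Function.Injective (polyOp p) := by
  refine (injective_iff_map_eq_zero _).2 fun f hf => Lp.ext ?_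
  have h : (polyOp p f : L2Torus) =ᵐ[torusMeasure] (0 : UnitAddTorus (Fin 2) → ℂ) := by
    rw [hf]
    exact Lp.coeFn_zero ℂ 2 torusMeasure
  filter_upwards [coeFn_mulOp _ (memLp_eval p) f, h, hp.ae_ne_zero,
    Lp.coeFn_zero ℂ 2 torusMeasure] with x h1 h2 h3 h4
  rw [polyOp, h1] at h2
  rw [h4]
  exact (mul_eq_zero.1 h2).resolve_left h3

theorem innerOp_shift (hp : IsInnerDenominator m n p) (i : Fin 2) (a : ℤ) (f : L2Torus) :
    hp.innerOp (shift i a f) = shift i a (hp.innerOp f) :=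
  mulOp_comm _ _ f

theorem innerOpAdj_shift (hp : IsInnerDenominator m n p) (i : Fin 2) (a : ℤ) (f : L2Torus) :
    hp.innerOpAdj (shift i a f) = shift i a (hp.innerOpAdj f) :=
  mulOp_comm _ _ f

theorem torusCoeff_innerOp_torusChar (hp : IsInnerDenominator m n p) {k a : Fin 2 → ℤ}
    (h : ∃ i, k i < a i) : torusCoeff k (hp.innerOp (torusChar a)) = 0 := by
  have h0 : ∃ i, (k - a : Fin 2 → ℤ) i < 0 := by
    obtain ⟨i, hi⟩ := h
    exact ⟨i, by rw [Pi.sub_apply]; omega⟩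
  rw [← hp.integral_rationalInner_eq_zero h0, ← mFourierCoeff_eq, UnitAddTorus.mFourierCoeff]
  refine integral_congr_ae ?_
  filter_upwards [coeFn_mulOp _ hp.memLp (torusChar a), coeFn_torusChar a] with x h1 h2
  rw [innerOp, h1, h2, neg_sub, sub_eq_add_neg, add_comm, UnitAddTorus.mFourier_add, smul_eq_mul]
  ring

theorem torusCoeff_innerOpAdj (hp : IsInnerDenominator m n p) (k : Fin 2 → ℤ) (f : L2Torus) :
    torusCoeff k (hp.innerOpAdj f) = ⟪hp.innerOp (torusChar k), f⟫_ℂ := by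
  rw [inner_innerOp_left, torusCoeff_apply]

/-- The coefficients of `conj Θ f` vanish at `k` unless `f` has a nonzero coefficient at some
`a ≥ k`. -/
theorem torusCoeff_innerOpAdj_eq_zero (hp : IsInnerDenominator m n p) {k : Fin 2 → ℤ}
    {f : L2Torus} (h : ∀ a, (∀ i, k i ≤ a i) → torusCoeff a f = 0) :
    torusCoeff k (hp.innerOpAdj f) = 0 := by
  rw [torusCoeff_innerOpAdj]
  refine inner_eq_zero_of_torusCoeff fun a => ?_
  by_cases ha : ∀ i, k i ≤ a i
  · exact Or.inr (h a ha)
  · push Not at ha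
    exact Or.inl (hp.torusCoeff_innerOp_torusChar ha)

/-- By duality: `conj Θ` moves a character to indices componentwise at most its own, and these miss
the quadrant `ℕ²` as soon as one component is negative. -/
theorem innerOp_mem (hp : IsInnerDenominator m n p) {f : L2Torus} (hf : f ∈ hardyBidisk) :
    hp.innerOp f ∈ hardyBidisk := by
  rw [mem_hardyBidisk] at hf ⊢
  intro k hk
  rw [torusCoeff_apply, ← inner_innerOpAdj_left]
  refine inner_eq_zero_of_torusCoeff fun a => ?_
  by_cases ha : ∃ i, a i < 0
  · exact Or.inr (hf a ha)
  · left
    refine hp.torusCoeff_innerOpAdj_eq_zero fun b hb => ?_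
    rw [torusCoeff_torusChar, if_neg]
    rintro rfl
    push Not at ha
    obtain ⟨i, hi⟩ := hk
    exact absurd (hb i) (by linarith [ha i])

/-- The model space of `Θ`. -/
abbrev model (hp : IsInnerDenominator m n p) : Submodule ℂ L2Torus :=
  modelSpace (fun x => rationalInner m n p (torusPt x)) hp.memLp

theorem mem_model (hp : IsInnerDenominator m n p) {f : L2Torus} :
    f ∈ hp.model ↔ f ∈ hardyBidisk ∧ ∀ h ∈ hardyBidisk, ⟪hp.innerOp h, f⟫_ℂ = 0 := by
  rw [model, modelSpace, Submodule.mem_inf, Submodule.mem_orthogonal]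
  refine and_congr_right fun _ => ⟨fun h g hg => h _ (Submodule.mem_map_of_mem hg), ?_⟩
  rintro h _ ⟨g, hg, rfl⟩
  exact h g hg

theorem torusCoeff_innerOpAdj_of_mem_model (hp : IsInnerDenominator m n p) {f : L2Torus}
    (hf : f ∈ hp.model) {k : Fin 2 → ℤ} (hk : ¬ ∃ i, k i < 0) :
    torusCoeff k (hp.innerOpAdj f) = 0 := by
  rw [torusCoeff_innerOpAdj]
  exact (hp.mem_model.1 hf).2 _ (torusChar_mem hk)

/-- The model space is invariant under the backward shifts. -/
theorem backShift_mem_model (hp : IsInnerDenominator m n p) (i : Fin 2) {f : L2Torus}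
    (hf : f ∈ hp.model) : backShift i f ∈ hp.model := by
  rw [hp.mem_model] at hf ⊢
  refine ⟨backShift_mem i f, fun h hh => ?_⟩
  rw [inner_backShift i (hp.innerOp_mem hh), ← innerOp_shift]
  exact hf.2 _ (by exact_mod_cast shift_mem i 1 hh)

/-- For `A ∈ H²`, the function `A - Θ P (conj Θ A)` lies in the model space. -/
theorem sub_innerOp_mem_model (hp : IsInnerDenominator m n p) {A : L2Torus}
    (hA : A ∈ hardyBidisk) : A - hp.innerOp (hardyProj (hp.innerOpAdj A)) ∈ hp.model := by
  refine hp.mem_model.2 ⟨hardyBidisk.sub_mem hA (hp.innerOp_mem (hardyProj_mem _)),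
    fun h hh => ?_⟩
  rw [inner_sub_right, inner_innerOp_left, inner_innerOp_left, innerOpAdj_innerOp,
    inner_hardyProj hh, sub_self]

/-- If `z_i ^ l f` lies in the model space for all `l`, then `p f` has degree less than that of
`p̃` in the other variable `z_j`. -/
theorem torusCoeff_polyOp_of_shift_mem_model (hp : IsInnerDenominator m n p) {i j : Fin 2}
    (hij : i ≠ j) {f : L2Torus} (hf : ∀ l : ℕ, shift i l f ∈ hp.model) {k : Fin 2 → ℤ}
    (hk : ((![m, n] : Fin 2 → ℕ) j : ℤ) ≤ k j) : torusCoeff k (polyOp p f) = 0 := by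
  rw [← hp.polyOp_reflection_innerOpAdj]
  refine torusCoeff_polyOp_eq_zero (i := j) (r := 0) (degreeOf_reflection_le m n p j)
    (fun l hl => ?_) (by simpa using hk)
  -- The index `l` has `l j ≥ 0`, but `l i` may be negative. Multiplication by `z_i ^ |l i|` moves
  -- it into the quadrant, where membership in the model space kills the coefficient.
  have h := hp.torusCoeff_innerOpAdj_of_mem_model (hf (l i).natAbs)
    (k := l + Pi.single i ((l i).natAbs : ℤ)) ?_
  · rwa [innerOpAdj_shift, torusCoeff_shift, add_sub_cancel_right] at h
  · push Not
    intro c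
    rw [Pi.add_apply, Pi.single_apply]
    split_ifs with hc
    · subst hc; omega
    · have : c = j := by omega
      subst this; omega

end IsInnerDenominator

/-! ### Invariant decompositions of the model space -/

namespace IsInvariantDecomposition

variable {K S₁ S₂ : Submodule ℂ L2Torus}

theorem fst_le (hS : IsInvariantDecomposition K S₁ S₂) : S₁ ≤ K := hS.sup_eq ▸ le_sup_left

theorem snd_le (hS : IsInvariantDecomposition K S₁ S₂) : S₂ ≤ K := hS.sup_eq ▸ le_sup_right

/-- `S₁` is the full orthogonal complement of `S₂` in `K`: an element of `K` orthogonal to `S₂` has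
zero `S₂`-component. -/
theorem mem_fst (hS : IsInvariantDecomposition K S₁ S₂) {x : L2Torus} (hx : x ∈ K)
    (h : ∀ s ∈ S₂, ⟪s, x⟫_ℂ = 0) : x ∈ S₁ := by
  rw [← hS.sup_eq, Submodule.mem_sup] at hx
  obtain ⟨y, hy, z, hz, rfl⟩ := hx
  have h1 := h z hz
  rw [inner_add_right, hS.orthogonal.symm.inner_eq hz hy, zero_add, inner_self_eq_zero] at h1
  rwa [h1, add_zero]

theorem mem_snd (hS : IsInvariantDecomposition K S₁ S₂) {x : L2Torus} (hx : x ∈ K)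
    (h : ∀ s ∈ S₁, ⟪s, x⟫_ℂ = 0) : x ∈ S₂ := by
  rw [← hS.sup_eq, Submodule.mem_sup] at hx
  obtain ⟨y, hy, z, hz, rfl⟩ := hx
  have h1 := h y hy
  rw [inner_add_right, hS.orthogonal.inner_eq hy hz, add_zero, inner_self_eq_zero] at h1
  rwa [h1, zero_add]

theorem shift_mem_fst (hS : IsInvariantDecomposition K S₁ S₂) (l : ℕ) {x : L2Torus}
    (hx : x ∈ S₁) : shift 0 l x ∈ S₁ := by
  induction l with
  | zero => simpa [shift_zero] using hx
  | succ l ih =>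
    rw [Nat.cast_succ, add_comm, ← shift_shift, ← coordMul_eq_shift]
    exact hS.invariant_fst (Submodule.mem_map_of_mem ih)

theorem shift_mem_snd (hS : IsInvariantDecomposition K S₁ S₂) (l : ℕ) {x : L2Torus}
    (hx : x ∈ S₂) : shift 1 l x ∈ S₂ := by
  induction l with
  | zero => simpa [shift_zero] using hx
  | succ l ih =>
    rw [Nat.cast_succ, add_comm, ← shift_shift, ← coordMul_eq_shift]
    exact hS.invariant_snd (Submodule.mem_map_of_mem ih)

end IsInvariantDecomposition

theorem mem_wandering {S : Submodule ℂ L2Torus} {x : L2Torus} :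
    x ∈ wandering S ↔ x ∈ S ∧ ∀ s ∈ S, ⟪shift 1 1 s, x⟫_ℂ = 0 := by
  rw [wandering, Submodule.mem_inf, Submodule.mem_orthogonal]
  refine and_congr_right fun _ => ⟨fun h g hg => ?_, ?_⟩
  · rw [← coordMul_eq_shift]
    exact h _ (Submodule.mem_map_of_mem hg)
  · rintro h _ ⟨g, hg, rfl⟩
    rw [coordMul_eq_shift]
    exact h g hg

/-! ### Degree bounds for `S₁`, `S₂` and `S₂ ⊖ z₂ S₂` -/

namespace IsInnerDenominator

variable {m n : ℕ} {p : MvPolynomial (Fin 2) ℂ} {S₁ S₂ : Submodule ℂ L2Torus}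

theorem le_hardyBidisk (hp : IsInnerDenominator m n p) : hp.model ≤ hardyBidisk := inf_le_left

theorem torusCoeff_polyOp_of_mem_fst (hp : IsInnerDenominator m n p)
    (hS : IsInvariantDecomposition hp.model S₁ S₂) {x : L2Torus} (hx : x ∈ S₁) {k : Fin 2 → ℤ}
    (hk : (n : ℤ) ≤ k 1) : torusCoeff k (polyOp p x) = 0 :=
  hp.torusCoeff_polyOp_of_shift_mem_model (i := 0) (j := 1) (by decide)
    (fun l => hS.fst_le (hS.shift_mem_fst l hx)) hk

theorem torusCoeff_polyOp_of_mem_snd (hp : IsInnerDenominator m n p)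
    (hS : IsInvariantDecomposition hp.model S₁ S₂) {x : L2Torus} (hx : x ∈ S₂) {k : Fin 2 → ℤ}
    (hk : (m : ℤ) ≤ k 0) : torusCoeff k (polyOp p x) = 0 :=
  hp.torusCoeff_polyOp_of_shift_mem_model (i := 1) (j := 0) (by decide)
    (fun l => hS.snd_le (hS.shift_mem_snd l hx)) hk

/-- `B₁` preserves the model space and is adjoint to multiplication by `z₁`, which preserves `S₁`;
so `B₁` preserves the complement of `S₁`. -/
theorem backShift_mem_snd (hp : IsInnerDenominator m n p)
    (hS : IsInvariantDecomposition hp.model S₁ S₂) {x : L2Torus} (hx : x ∈ S₂) :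
    backShift 0 x ∈ S₂ := by
  refine hS.mem_snd (hp.backShift_mem_model 0 (hS.snd_le hx)) fun s hs => ?_
  rw [inner_backShift 0 (hp.le_hardyBidisk (hS.fst_le hs))]
  exact hS.orthogonal.inner_eq (by exact_mod_cast hS.shift_mem_fst 1 hs) hx

/-- Orthogonality of `x` to `z₂S₂` says that `B₂x` is orthogonal to `S₂`. This is how the
`z₂`-degree bound for `S₁` reaches the wandering subspace. -/
theorem backShift_mem_fst (hp : IsInnerDenominator m n p)
    (hS : IsInvariantDecomposition hp.model S₁ S₂) {x : L2Torus} (hx : x ∈ wandering S₂) :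
    backShift 1 x ∈ S₁ := by
  rw [mem_wandering] at hx
  refine hS.mem_fst (hp.backShift_mem_model 1 (hS.snd_le hx.1)) fun s hs => ?_
  rw [inner_backShift 1 (hp.le_hardyBidisk (hS.snd_le hs))]
  exact hx.2 s hs

/-- For `x ∈ S₂ ⊖ z₂ S₂`, the function `p x` has degree at most `n` in `z₂`. -/
theorem torusCoeff_polyOp_of_mem_wandering (hp : IsInnerDenominator m n p)
    (hS : IsInvariantDecomposition hp.model S₁ S₂) {x : L2Torus} (hx : x ∈ wandering S₂)
    {k : Fin 2 → ℤ} (hk : (n : ℤ) < k 1) : torusCoeff k (polyOp p x) = 0 := by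
  have hxH : x ∈ hardyBidisk := hp.le_hardyBidisk (hS.snd_le (mem_wandering.1 hx).1)
  -- After multiplication by `p`, the first term has `z₂`-degree at most `n` because `B₂x` is in
  -- `S₁`; the second is `p` times a function of `z₁` alone.
  have hdec : x = shift 1 1 (backShift 1 x) + (x - shift 1 1 (backShift 1 x)) := by abel
  rw [hdec, map_add, map_add, polyOp_shift, torusCoeff_shift,
    hp.torusCoeff_polyOp_of_mem_fst hS (hp.backShift_mem_fst hS hx), zero_add]
  · refine torusCoeff_polyOp_eq_zero (i := 1) (r := 1) hp.degree_snd (fun l hl => ?_) (by omega)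
    exact torusCoeff_sub_shift_backShift 1 hxH (by omega)
  · simp only [Pi.sub_apply, Pi.single_eq_same]
    omega

/-- Every element of `S₂ ⊖ z₂ S₂` has the form `q / p` with a polynomial `q`. -/
theorem exists_polyFn_of_mem_wandering (hp : IsInnerDenominator m n p)
    (hS : IsInvariantDecomposition hp.model S₁ S₂) {x : L2Torus} (hx : x ∈ wandering S₂) :
    ∃ q : MvPolynomial (Fin 2) ℂ, polyFn q = polyOp p x := by
  have hxS := (mem_wandering.1 hx).1
  obtain ⟨q, hq, -⟩ := exists_polyFn_eq (N := ![m, n])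
    (polyOp_mem p (hp.le_hardyBidisk (hS.snd_le hxS))) (fun k i hi => by
      fin_cases i
      · exact hp.torusCoeff_polyOp_of_mem_snd hS hxS (le_of_lt hi)
      · exact hp.torusCoeff_polyOp_of_mem_wandering hS hx hi)
  exact ⟨q, hq⟩

/-- If `q / p ∈ S₂` with a polynomial `q`, then `q` has degree less than `m` in `z₁`. -/
theorem lt_of_mem_support (hp : IsInnerDenominator m n p)
    (hS : IsInvariantDecomposition hp.model S₁ S₂) {x : L2Torus} (hx : x ∈ S₂)
    {q : MvPolynomial (Fin 2) ℂ} (hq : polyFn q = polyOp p x) {a : Fin 2 →₀ ℕ}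
    (ha : a ∈ q.support) : a 0 < m := by
  by_contra! hc
  refine mem_support_iff.1 ha ?_
  rw [← torusCoeff_polyFn_expo, hq]
  exact hp.torusCoeff_polyOp_of_mem_snd hS hx (by simpa [expo] using hc)

theorem degreeOf_of_mem_wandering (hp : IsInnerDenominator m n p)
    (hS : IsInvariantDecomposition hp.model S₁ S₂) {x : L2Torus} (hx : x ∈ wandering S₂)
    {q : MvPolynomial (Fin 2) ℂ} (hq : polyFn q = polyOp p x) :
    q.degreeOf 0 ≤ m - 1 ∧ q.degreeOf 1 ≤ n := by
  constructor
  · rw [degreeOf_le_iff]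
    intro a ha
    -- For `m = 0` the strict bound leaves no exponents, so the truncated `m - 1` does no harm.
    have := hp.lt_of_mem_support hS (mem_wandering.1 hx).1 hq ha
    omega
  · rw [degreeOf_le_iff]
    intro a ha
    by_contra! hc
    refine mem_support_iff.1 ha ?_
    rw [← torusCoeff_polyFn_expo, hq]
    exact hp.torusCoeff_polyOp_of_mem_wandering hS hx (by simpa [expo] using hc)

end IsInnerDenominator

/-! ### The Wold decomposition of `S₂` -/

/-- One Wold step, `S = W ⊕ z₂S`. With `y` the projection of `z₂⁻¹x` to `S`, the remainder `x - z₂y`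
lies in `W` and is orthogonal both to `x` and to `z₂y`. -/
theorem exists_shift_eq_of_inner_wandering {S : Submodule ℂ L2Torus} [CompleteSpace S]
    (hS : ∀ s ∈ S, shift 1 1 s ∈ S) {x : L2Torus} (hx : x ∈ S)
    (h : ∀ w ∈ wandering S, ⟪w, x⟫_ℂ = 0) : ∃ y ∈ S, shift 1 1 y = x := by
  let y : L2Torus := S.starProjection (shift 1 (-1) x)
  have hy : y ∈ S := S.starProjection_apply_mem _
  have hin : ∀ s ∈ S, ⟪shift 1 1 s, x - shift 1 1 y⟫_ℂ = 0 := by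
    intro s hs
    have h1 := Submodule.starProjection_inner_eq_zero (K := S) (shift 1 (-1) x) s hs
    rw [← inner_conj_symm, map_eq_zero, inner_sub_right] at h1
    rw [inner_sub_right, inner_shift_left, inner_shift_left, shift_shift, neg_add_cancel,
      shift_zero]
    exact h1
  have hw : x - shift 1 1 y ∈ wandering S := mem_wandering.2 ⟨S.sub_mem hx (hS y hy), hin⟩
  have h0 : ⟪x - shift 1 1 y, x - shift 1 1 y⟫_ℂ = 0 := by
    rw [inner_sub_right, h _ hw, zero_sub, neg_eq_zero, ← inner_conj_symm, hin y hy, map_zero]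
  exact ⟨y, hy, (sub_eq_zero.1 (inner_self_eq_zero.1 h0)).symm⟩

/-- There is no unitary part: such an `x` lies in `z₂^l S` for every `l`, so all its Fourier
coefficients vanish, because `S` is inside `H²`. -/
theorem eq_zero_of_inner_shift_wandering {S : Submodule ℂ L2Torus} [CompleteSpace S]
    (hS : ∀ s ∈ S, shift 1 1 s ∈ S) (hH : S ≤ hardyBidisk) {x : L2Torus} (hx : x ∈ S)
    (h : ∀ w ∈ wandering S, ∀ l : ℕ, ⟪shift 1 l w, x⟫_ℂ = 0) : x = 0 := by
  have key : ∀ l : ℕ, ∃ y ∈ S, shift 1 l y = x := by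
    intro l
    induction l with
    | zero => exact ⟨x, hx, by simp [shift_zero]⟩
    | succ l ih =>
      obtain ⟨y, hy, rfl⟩ := ih
      obtain ⟨z, hz, rfl⟩ := exists_shift_eq_of_inner_wandering hS hy fun w hw => by
        have := h w hw l
        rwa [inner_shift_left, shift_shift, neg_add_cancel, shift_zero] at this
      exact ⟨z, hz, by rw [shift_shift]; push_cast; rfl⟩
  refine torus_ext fun k => ?_
  obtain ⟨y, hy, rfl⟩ := key ((k 1).toNat + 1)
  rw [torusCoeff_shift, map_zero]
  refine mem_hardyBidisk.1 (hH hy) _ ⟨1, ?_⟩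
  simp only [Pi.sub_apply, Pi.single_eq_same]
  omega

/-- A function orthogonal to all `z₂ ^ l e_i`, where the `e_i` span `S ⊖ z₂ S`, is orthogonal to
`S`. -/
theorem inner_eq_zero_of_inner_shift {S : Submodule ℂ L2Torus} [CompleteSpace S]
    (hS : ∀ (l : ℕ), ∀ s ∈ S, shift 1 l s ∈ S) (hH : S ≤ hardyBidisk) {ι : Type*}
    {e : ι → L2Torus} (he : Submodule.span ℂ (Set.range e) = wandering S) {x : L2Torus}
    (h : ∀ i, ∀ l : ℕ, ⟪shift 1 l (e i), x⟫_ℂ = 0) {s : L2Torus} (hs : s ∈ S) :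
    ⟪s, x⟫_ℂ = 0 := by
  -- Here `x` need not lie in `S`; the preceding lemma is applied to its projection, which has the
  -- same inner products with `S`.
  have hproj : ∀ t ∈ S, ⟪t, S.starProjection x⟫_ℂ = ⟪t, x⟫_ℂ := by
    intro t ht
    have h1 := Submodule.starProjection_inner_eq_zero (K := S) x t ht
    rw [← inner_conj_symm, map_eq_zero, inner_sub_right, sub_eq_zero] at h1
    exact h1.symm
  have h0 : S.starProjection x = 0 := by
    refine eq_zero_of_inner_shift_wandering (S := S) (fun s hs => by exact_mod_cast hS 1 s hs) hH
      (S.starProjection_apply_mem x) fun w hw l => ?_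
    rw [hproj _ (hS l w (mem_wandering.1 hw).1)]
    rw [← he] at hw
    induction hw using Submodule.span_induction with
    | mem y hy =>
      obtain ⟨i, rfl⟩ := hy
      exact h i l
    | zero => rw [map_zero, inner_zero_left]
    | add y z _ _ hy hz => rw [map_add, inner_add_left, hy, hz, add_zero]
    | smul c y _ hy => rw [map_smul, inner_smul_left, hy, mul_zero]
  rw [← hproj s hs, h0, inner_zero_right]

/-- The functions `z₂ ^ k e_i` for a family `e` in `S₂ ⊖ z₂ S₂`. -/
theorem orthonormal_shift_wandering {S : Submodule ℂ L2Torus}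
    (hS : ∀ (l : ℕ), ∀ s ∈ S, shift 1 l s ∈ S) {d : ℕ} {e : Fin d → L2Torus}
    (he : Orthonormal ℂ e) (hW : ∀ i, e i ∈ wandering S) :
    Orthonormal ℂ fun a : Fin d × ℕ => shift 1 a.2 (e a.1) := by
  have hlt : ∀ (i j : Fin d) (k l : ℕ), k < l → ⟪shift 1 l (e i), shift 1 k (e j)⟫_ℂ = 0 := by
    intro i j k l hkl
    obtain ⟨r, rfl⟩ := Nat.exists_eq_add_of_lt hkl
    rw [inner_shift_right, shift_shift]
    have := (mem_wandering.1 (hW j)).2 _ (hS r _ (mem_wandering.1 (hW i)).1)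
    rw [shift_shift] at this
    rwa [show -(k : ℤ) + ((k + r + 1 : ℕ) : ℤ) = 1 + r by push_cast; ring]
  rw [orthonormal_iff_ite]
  rintro ⟨i, k⟩ ⟨j, l⟩
  dsimp only
  rcases lt_trichotomy k l with h | rfl | h
  · rw [← inner_conj_symm, hlt _ _ _ _ h, map_zero, if_neg]
    simp only [Prod.mk.injEq, not_and]
    omega
  · rw [inner_shift_left, shift_shift, neg_add_cancel, shift_zero,
      orthonormal_iff_ite.1 he i j]
    simp
  · rw [hlt _ _ _ _ h, if_neg]
    simp only [Prod.mk.injEq, not_and]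
    omega

/-- The embedding of functions of `z₂` into functions on the torus. -/
def sndEmb : L2Circle →ₗᵢ[ℂ] L2Torus :=
  Lp.compMeasurePreservingₗᵢ ℂ (Function.eval 1)
    (measurePreserving_eval (fun _ : Fin 2 => circleMeasure) 1)

theorem coeFn_sndEmb (f : L2Circle) : sndEmb f =ᵐ[torusMeasure] fun x => f (x 1) :=
  Lp.coeFn_compMeasurePreserving f
    (measurePreserving_eval (fun _ : Fin 2 => circleMeasure) 1)

theorem sndEmb_circleChar (k : ℤ) : sndEmb (circleChar k) = torusChar (Pi.single 1 k) := by
  refine Lp.ext ?_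
  have h := (measurePreserving_eval (fun _ : Fin 2 => circleMeasure) 1).quasiMeasurePreserving.ae
    (coeFn_circleChar k)
  filter_upwards [coeFn_sndEmb (circleChar k), coeFn_torusChar (Pi.single 1 k), h] with x h1 h2 h3
  rw [h1, h2, mFourier_eq_zpow]
  simp only [Function.eval] at h3
  rw [h3, fourier_eq_zpow, torusPt]
  simp [torusPt]

theorem circle_clm_ext {F : Type*} [NormedAddCommGroup F] [NormedSpace ℂ F]
    {A B : L2Circle →L[ℂ] F} (h : ∀ k, A (circleChar k) = B (circleChar k)) : A = B := by
  refine ContinuousLinearMap.ext_on (s := Set.range circleChar) ?_ ?_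
  · have := (fourierBasis (T := 1)).dense_span
    rw [show (⇑(fourierBasis (T := 1))) = circleChar from funext fourierBasis_apply] at this
    exact Submodule.dense_iff_topologicalClosure_eq_top.2 this
  · rintro _ ⟨k, rfl⟩
    exact h k

theorem torusCoeff_sndEmb (k : Fin 2 → ℤ) (f : L2Circle) :
    torusCoeff k (sndEmb f) = if k 0 = 0 then circleCoeff (k 1) f else 0 := by
  have h : torusCoeff k ∘L sndEmb.toContinuousLinearMap =
      if k 0 = 0 then circleCoeff (k 1) else 0 := by
    refine circle_clm_ext fun l => ?_
    have h2 : (k = Pi.single 1 l) ↔ k 0 = 0 ∧ k 1 = l := by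
      rw [funext_iff, Fin.forall_fin_two]
      simp
    change torusCoeff k (sndEmb (circleChar l)) = _
    rw [sndEmb_circleChar, torusCoeff_torusChar]
    simp only [h2]
    split_ifs with h3 h4 h4
    · rw [circleCoeff_circleChar, if_pos h3.2]
    · exact absurd h3.1 h4
    · rw [circleCoeff_circleChar, if_neg fun h5 => h3 ⟨h4, h5⟩]
    · rfl
  have h3 := DFunLike.congr_fun h f
  change torusCoeff k (sndEmb f) = _ at h3
  rw [h3]
  split_ifs <;> rfl

/-! ### The Hilbert basis of `H²(𝔻)^d` -/

/-- The vector-valued function with entry `z^k` at position `i`. -/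
def hardyVecChar (d : ℕ) (a : Fin d × ℕ) : hardyVec d :=
  ⟨PiLp.single 2 a.1 (circleChar a.2), fun i => by
    by_cases h : i = a.1
    · subst h
      rw [PiLp.single_eq_same]
      exact mem_hardyDisk.2 fun k hk => by rw [circleCoeff_circleChar, if_neg (by omega)]
    · rw [PiLp.single_eq_of_ne _ h]
      exact hardyDisk.zero_mem⟩

theorem inner_hardyVecChar {d : ℕ} (a : Fin d × ℕ) (f : L2CircleVec d) :
    ⟪(hardyVecChar d a : L2CircleVec d), f⟫_ℂ = circleCoeff a.2 (f a.1) := by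
  rw [hardyVecChar, PiLp.inner_apply, Finset.sum_eq_single a.1]
  · rw [PiLp.single_eq_same]; rfl
  · intro i _ hi
    rw [PiLp.single_eq_of_ne _ hi, inner_zero_left]
  · simp

theorem orthonormal_hardyVecChar (d : ℕ) : Orthonormal ℂ (hardyVecChar d) := by
  rw [orthonormal_iff_ite]
  rintro ⟨i, k⟩ ⟨j, l⟩
  rw [Submodule.coe_inner, inner_hardyVecChar]
  dsimp only [hardyVecChar]
  by_cases h : i = j
  · subst h
    rw [PiLp.single_eq_same, circleCoeff_circleChar]
    simp
  · rw [PiLp.single_eq_of_ne _ h, map_zero, if_neg]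
    simp [h]

/-- The functions `hardyVecChar` as a Hilbert basis of `H²(𝔻)^d`. -/
def hardyVecBasis (d : ℕ) : HilbertBasis (Fin d × ℕ) ℂ (hardyVec d) :=
  HilbertBasis.mkOfOrthogonalEqBot (orthonormal_hardyVecChar d) (by
    rw [eq_bot_iff]
    intro f hf
    rw [Submodule.mem_orthogonal] at hf
    rw [Submodule.mem_bot]
    refine Subtype.ext (PiLp.ext fun i => circle_ext fun k => ?_)
    by_cases hk : k < 0
    · rw [mem_hardyDisk.1 (f.2 i) k hk]
      exact (map_zero _).symm
    · lift k to ℕ using not_lt.1 hk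
      have := hf _ (Submodule.subset_span ⟨(i, k), rfl⟩)
      rw [Submodule.coe_inner, inner_hardyVecChar] at this
      rw [this]
      exact (map_zero _).symm)

theorem hardyVecBasis_apply (d : ℕ) (a : Fin d × ℕ) : hardyVecBasis d a = hardyVecChar d a := by
  rw [hardyVecBasis, HilbertBasis.coe_mkOfOrthogonalEqBot]

/-! ### The unitary operator `H²(𝔻)^d → S₂` -/

/-- By the Wold decomposition the functions `z₂^k e_i` form a Hilbert basis of `S`, and `U` matches
it with the standard basis of `H²(𝔻)^d`. Later arguments use `U` only through its values on this
basis. -/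
theorem exists_unitary {S : Submodule ℂ L2Torus} [CompleteSpace S]
    (hS : ∀ (l : ℕ), ∀ s ∈ S, shift 1 l s ∈ S) (hH : S ≤ hardyBidisk) {d : ℕ}
    {e : Fin d → L2Torus} (he : Orthonormal ℂ e)
    (hspan : Submodule.span ℂ (Set.range e) = wandering S) :
    ∃ U : hardyVec d ≃ₗᵢ[ℂ] S,
      ∀ a, (U (hardyVecChar d a) : L2Torus) = shift 1 a.2 (e a.1) := by
  have hW : ∀ i, e i ∈ wandering S := fun i => hspan ▸ Submodule.subset_span ⟨i, rfl⟩
  let v : Fin d × ℕ → S := fun a => ⟨shift 1 a.2 (e a.1), hS _ _ (mem_wandering.1 (hW a.1)).1⟩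
  have hv : Orthonormal ℂ v := by
    have := orthonormal_shift_wandering hS he hW
    rw [orthonormal_iff_ite] at this ⊢
    exact this
  have hbot : (Submodule.span ℂ (Set.range v))ᗮ = ⊥ := by
    rw [eq_bot_iff]
    intro x hx
    rw [Submodule.mem_orthogonal] at hx
    have h0 : ∀ s ∈ S, ⟪s, (x : L2Torus)⟫_ℂ = 0 := fun s hs =>
      inner_eq_zero_of_inner_shift hS hH hspan
        (fun i l => hx (v (i, l)) (Submodule.subset_span ⟨(i, l), rfl⟩)) hs
    rw [Submodule.mem_bot]
    exact Subtype.ext (inner_self_eq_zero.1 (h0 x x.2))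
  let b : HilbertBasis (Fin d × ℕ) ℂ S := HilbertBasis.mkOfOrthogonalEqBot hv hbot
  refine ⟨(hardyVecBasis d).repr.trans b.repr.symm, fun a => ?_⟩
  rw [LinearIsometryEquiv.trans_apply, ← hardyVecBasis_apply, HilbertBasis.repr_self,
    HilbertBasis.repr_symm_single, HilbertBasis.coe_mkOfOrthogonalEqBot]

theorem hardyVec_clm_ext {d : ℕ} {F : Type*} [NormedAddCommGroup F] [NormedSpace ℂ F]
    {A B : hardyVec d →L[ℂ] F} (h : ∀ a, A (hardyVecChar d a) = B (hardyVecChar d a)) :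
    A = B := by
  refine ContinuousLinearMap.ext_on (s := Set.range (hardyVecBasis d)) ?_ ?_
  · exact Submodule.dense_iff_topologicalClosure_eq_top.2 (hardyVecBasis d).dense_span
  · rintro _ ⟨k, rfl⟩
    rw [hardyVecBasis_apply]
    exact h k

/-- The formula `Σ (q_i/p) f_i` with the denominator cleared: both sides are then bounded operators,
so comparison on the basis suffices, although each `1/p` may be unbounded. -/
theorem polyOp_unitary {S : Submodule ℂ L2Torus} {d : ℕ} {e : Fin d → L2Torus}
    {U : hardyVec d ≃ₗᵢ[ℂ] S}
    (hU : ∀ a, (U (hardyVecChar d a) : L2Torus) = shift 1 a.2 (e a.1))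
    {p : MvPolynomial (Fin 2) ℂ} {q : Fin d → MvPolynomial (Fin 2) ℂ}
    (hq : ∀ i, polyFn (q i) = polyOp p (e i)) (f : hardyVec d) :
    polyOp p (U f) = ∑ i, polyOp (q i) (sndEmb ((f : L2CircleVec d) i)) := by
  let A : hardyVec d →L[ℂ] L2Torus :=
    polyOp p ∘L S.subtypeL ∘L (U : hardyVec d →L[ℂ] S)
  let B : hardyVec d →L[ℂ] L2Torus :=
    ∑ i, polyOp (q i) ∘L sndEmb.toContinuousLinearMap ∘L
      PiLp.proj 2 (fun _ : Fin d => L2Circle) i ∘L (hardyVec d).subtypeL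
  have hB : ∀ f, B f = ∑ i, polyOp (q i) (sndEmb ((f : L2CircleVec d) i)) := fun f => by
    simp only [B, sum_apply]
    rfl
  have hAB : A = B := by
    refine hardyVec_clm_ext fun a => ?_
    rw [hB, Finset.sum_eq_single a.1]
    · change polyOp p (U (hardyVecChar d a) : L2Torus) = _
      rw [hU, polyOp_shift, ← hq, polyFn, hardyVecChar, PiLp.single_eq_same, sndEmb_circleChar,
        ← polyOp_shift, shift, charOp_torusChar, add_zero]
    · intro i _ hi
      rw [hardyVecChar, PiLp.single_eq_of_ne _ hi, map_zero, map_zero]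
    · simp
  rw [← hB, ← hAB]
  rfl

/-! ### Coefficients with respect to `z₁` -/

theorem circlePolyOp_monomial (a : ℕ) (c : ℂ) (f : L2Circle) :
    circlePolyOp (Polynomial.monomial a c) f = c • circleCharOp a f := by
  refine mulOp_eq_of_ae _ ?_
  filter_upwards [Lp.coeFn_smul c (circleCharOp a f),
    coeFn_mulOp _ (memLp_fourier (a : ℤ)) f] with x h1 h2
  rw [h1, Pi.smul_apply, circleCharOp, h2, Polynomial.eval_monomial, fourier_eq_zpow, smul_eq_mul,
    zpow_natCast, mul_assoc]

theorem circlePolyFn_sum {ι : Type*} (s : Finset ι) (P : ι → Polynomial ℂ) :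
    circlePolyFn (∑ i ∈ s, P i) = ∑ i ∈ s, circlePolyFn (P i) :=
  circlePolyOp_sum s P _

theorem circlePolyFn_zero : circlePolyFn 0 = 0 := circlePolyOp_zero _

/-- The coefficient of `z₁ ^ k` in a polynomial, as a polynomial in `z₂`. -/
def fstCoeff (k : ℕ) (q : MvPolynomial (Fin 2) ℂ) : Polynomial ℂ :=
  ∑ a ∈ q.support with a 0 = k, Polynomial.monomial (a 1) (q.coeff a)

/-- As `g` depends on `z₂` only, every power of `z₁` comes from `q`. Identities on the torus thus
become one-variable equations, one for each power of `z₁`. -/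
theorem torusCoeff_polyOp_sndEmb (q : MvPolynomial (Fin 2) ℂ) (g : L2Circle) {k : Fin 2 → ℤ}
    {k₀ : ℕ} (hk : k 0 = k₀) :
    torusCoeff k (polyOp q (sndEmb g)) = circleCoeff (k 1) (circlePolyOp (fstCoeff k₀ q) g) := by
  rw [torusCoeff_polyOp, fstCoeff, circlePolyOp_sum, map_sum, Finset.sum_filter]
  refine Finset.sum_congr rfl fun a _ => ?_
  rw [torusCoeff_sndEmb, circlePolyOp_monomial, map_smul, circleCoeff_circleCharOp, smul_eq_mul]
  have : (k - expo a) 0 = 0 ↔ a 0 = k₀ := by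
    rw [Pi.sub_apply, hk, expo]
    omega
  simp only [this]
  split_ifs
  · rfl
  · rw [mul_zero]

/-! ### The dimension of `S₂ ⊖ z₂ S₂` -/

namespace IsInnerDenominator

variable {m n : ℕ} {p : MvPolynomial (Fin 2) ℂ} {S₁ S₂ : Submodule ℂ L2Torus}

/-- The matrix of the coefficients with respect to `z₁` of the numerators of an orthonormal basis
of `S₂ ⊖ z₂ S₂` has trivial kernel. -/
theorem eq_zero_of_fstCoeff_mulVec (hp : IsInnerDenominator m n p)
    (hS : IsInvariantDecomposition hp.model S₁ S₂) {d : ℕ} {e : Fin d → L2Torus}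
    {U : hardyVec d ≃ₗᵢ[ℂ] S₂}
    (hU : ∀ a, (U (hardyVecChar d a) : L2Torus) = shift 1 a.2 (e a.1))
    {q : Fin d → MvPolynomial (Fin 2) ℂ} (hq : ∀ i, polyFn (q i) = polyOp p (e i))
    {v : Fin d → Polynomial ℂ} (hv : ∀ k < m, ∑ i, fstCoeff k (q i) * v i = 0) : v = 0 := by
  let f : hardyVec d := ⟨WithLp.toLp 2 fun i => circlePolyFn (v i), fun i => circlePolyFn_mem _⟩
  have hf : ∀ i, (f : L2CircleVec d) i = circlePolyFn (v i) := fun i => rfl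
  -- Coefficients at `z₁`-index `m` or more vanish by the degree bound for `S₂`, the lower ones by
  -- `hv`.
  have h0 : polyOp p (U f) = 0 := by
    refine torus_ext fun k => ?_
    rw [map_zero]
    by_cases hk : ∃ i, k i < 0
    · exact mem_hardyBidisk.1 (polyOp_mem p (hp.le_hardyBidisk (hS.snd_le (U f).2))) k hk
    · push Not at hk
      by_cases hkm : (m : ℤ) ≤ k 0
      · exact hp.torusCoeff_polyOp_of_mem_snd hS (U f).2 hkm
      · obtain ⟨k₀, hk₀⟩ := Int.eq_ofNat_of_zero_le (hk 0)
        rw [polyOp_unitary hU hq, map_sum]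
        simp only [torusCoeff_polyOp_sndEmb _ _ hk₀, hf, circlePolyOp_circlePolyFn]
        rw [← map_sum, ← circlePolyFn_sum, hv k₀ (by omega), circlePolyFn_zero, map_zero]
  have h1 : U f = 0 := Subtype.ext (hp.polyOp_injective (h0.trans (map_zero _).symm))
  have h2 : f = 0 := U.injective (h1.trans (map_zero U).symm)
  funext i
  refine circlePolyFn_injective ?_
  rw [← hf, h2, Pi.zero_apply, circlePolyFn_zero]
  rfl

/-- An injective linear map `ℂ[z₂]^d → ℂ[z₂]^m` forces `d ≤ m`. -/
theorem card_le (hp : IsInnerDenominator m n p)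
    (hS : IsInvariantDecomposition hp.model S₁ S₂) {d : ℕ} {e : Fin d → L2Torus}
    {U : hardyVec d ≃ₗᵢ[ℂ] S₂}
    (hU : ∀ a, (U (hardyVecChar d a) : L2Torus) = shift 1 a.2 (e a.1))
    {q : Fin d → MvPolynomial (Fin 2) ℂ} (hq : ∀ i, polyFn (q i) = polyOp p (e i)) : d ≤ m := by
  let Q : Matrix (Fin m) (Fin d) (Polynomial ℂ) := Matrix.of fun k i => fstCoeff k (q i)
  have hinj : Function.Injective Q.mulVecLin := by
    refine (injective_iff_map_eq_zero _).2 fun v hv => ?_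
    refine hp.eq_zero_of_fstCoeff_mulVec hS hU hq fun k hk => ?_
    exact congrFun hv ⟨k, hk⟩
  simpa using card_le_of_injective (Polynomial ℂ) Q.mulVecLin hinj

/-- The dimension of `S₂ ⊖ z₂ S₂` is at least `m`. -/
theorem le_card (hp : IsInnerDenominator m n p)
    (hS : IsInvariantDecomposition hp.model S₁ S₂) [CompleteSpace S₂] {d : ℕ}
    {e : Fin d → L2Torus} (hspan : Submodule.span ℂ (Set.range e) = wandering S₂) : m ≤ d := by
  by_contra! hd
  have heS : ∀ i, e i ∈ S₂ := fun i =>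
    (mem_wandering.1 (hspan ▸ Submodule.subset_span ⟨i, rfl⟩)).1
  -- Polynomials of degree below `m` in `z₁` and at most `N` in `z₂` have dimension `m(N+1)`. For `d
  -- < m` this exceeds `d(N+1)` by at least `N+1`, which is more than the `2mn` further conditions.
  let N : ℕ := 2 * m * n
  let χ : Fin m × Fin (N + 1) → (Fin 2 → ℤ) := fun a => ![(a.1 : ℤ), (a.2 : ℤ)]
  have hχ : Function.Injective χ := by
    rintro ⟨a, b⟩ ⟨c, d⟩ h
    have h0 := congrFun h 0
    have h1 := congrFun h 1
    simp only [χ, Matrix.cons_val_zero, Matrix.cons_val_one, Nat.cast_inj] at h0 h1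
    exact Prod.ext (Fin.ext h0) (Fin.ext h1)
  let A : (Fin m × Fin (N + 1) → ℂ) →ₗ[ℂ] L2Torus :=
    Fintype.linearCombination ℂ fun a => torusChar (χ a)
  have hA : ∀ α k, torusCoeff k (A α) = ∑ a, if k = χ a then α a else 0 := by
    intro α k
    simp [A, Fintype.linearCombination_apply, torusCoeff_torusChar]
  have hA0 : ∀ α k, (k 0 < 0 ∨ (m : ℤ) ≤ k 0 ∨ k 1 < 0 ∨ (N : ℤ) < k 1) →
      torusCoeff k (A α) = 0 := by
    intro α k hk
    rw [hA]
    refine Finset.sum_eq_zero fun a _ => if_neg ?_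
    rintro rfl
    simp only [χ, Matrix.cons_val_zero, Matrix.cons_val_one] at hk
    omega
  have hAH : ∀ α, A α ∈ hardyBidisk := fun α => mem_hardyBidisk.2 fun k ⟨i, hi⟩ => by
    refine hA0 α k ?_
    fin_cases i
    · exact Or.inl hi
    · exact Or.inr (Or.inr (Or.inl hi))
  let R : L2Torus →L[ℂ] L2Torus := hardyProj ∘L hp.innerOpAdj
  let D : L2Torus →L[ℂ] L2Torus := polyOp p - polyOp (reflection m n p) ∘L R
  -- The conditions on `A`: orthogonality to `z₂^l e_i` for `l ≤ N`, and vanishing of the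
  -- coefficients of `D A = p (A - Θ P(conj Θ A))` in the box `2m × n`.
  let Φ : (Fin m × Fin (N + 1) → ℂ) →ₗ[ℂ]
      (Fin d × Fin (N + 1) → ℂ) × (Fin (2 * m) × Fin n → ℂ) :=
    LinearMap.prod
      (LinearMap.pi fun a => (innerSL ℂ (shift 1 (a.2 : ℕ) (e a.1))).toLinearMap ∘ₗ A)
      (LinearMap.pi fun k => (torusCoeff ![(k.1 : ℤ), (k.2 : ℤ)] ∘L D).toLinearMap ∘ₗ A)
  have hker : Φ.ker ≠ ⊥ := by
    refine LinearMap.ker_ne_bot_of_finrank_lt ?_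
    simp only [Module.finrank_prod, Module.finrank_fintype_fun_eq_card, Fintype.card_prod,
      Fintype.card_fin]
    have h1 : d * (N + 1) + (N + 1) ≤ m * (N + 1) := by
      rw [← Nat.succ_mul]
      exact Nat.mul_le_mul_right _ hd
    simp only [N] at h1 ⊢
    omega
  obtain ⟨α, hα, hα0⟩ := Submodule.exists_mem_ne_zero_of_ne_bot hker
  rw [LinearMap.mem_ker] at hα
  have hα1 : ∀ i (l : Fin (N + 1)), ⟪shift 1 (l : ℕ) (e i), A α⟫_ℂ = 0 := fun i l =>
    congrFun (congrArg Prod.fst hα) (i, l)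
  have hα2 : ∀ (a : Fin (2 * m)) (b : Fin n),
      torusCoeff ![(a : ℤ), (b : ℤ)] (D (A α)) = 0 := fun a b =>
    congrFun (congrArg Prod.snd hα) (a, b)
  have horth : ∀ s ∈ S₂, ⟪s, A α⟫_ℂ = 0 := by
    refine fun s hs => inner_eq_zero_of_inner_shift (fun l s hs => hS.shift_mem_snd l hs)
      (hS.snd_le.trans hp.le_hardyBidisk) hspan (fun i l => ?_) hs
    by_cases hl : l ≤ N
    · exact hα1 i ⟨l, by omega⟩
    -- For `l > N` orthogonality is automatic: `z₂^l e_i` begins above the `z₂`-degree of `A`.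
    · refine inner_eq_zero_of_torusCoeff fun k => ?_
      by_cases hk : (N : ℤ) < k 1
      · exact Or.inr (hA0 α k (by omega))
      · left
        rw [torusCoeff_shift]
        refine mem_hardyBidisk.1 (hp.le_hardyBidisk (hS.snd_le (heS i))) _ ⟨1, ?_⟩
        simp only [Pi.sub_apply, Pi.single_eq_same]
        omega
  -- This is the component of `A` in the model space. Both `A` and `Θ H²` are orthogonal to `S₂`, so
  -- it belongs to `S₁`.
  have hx : A α - hp.innerOp (R (A α)) ∈ S₁ := by
    refine hS.mem_fst (hp.sub_innerOp_mem_model (hAH α)) fun s hs => ?_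
    rw [inner_sub_right, horth s hs, zero_sub, neg_eq_zero, ← inner_conj_symm, map_eq_zero]
    exact (hp.mem_model.1 (hS.snd_le hs)).2 _ (hardyProj_mem _)
  have hDx : D (A α) = polyOp p (A α - hp.innerOp (R (A α))) := by
    rw [map_sub, hp.polyOp_innerOp]
    rfl
  have hR0 : ∀ k, ((m : ℤ) ≤ k 0 ∨ (N : ℤ) < k 1) → torusCoeff k (R (A α)) = 0 := by
    intro k hk
    by_cases hk' : ∃ i, k i < 0
    · exact torusCoeff_hardyProj_of_neg hk' _
    · refine (torusCoeff_hardyProj hk' _).trans ?_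
      refine hp.torusCoeff_innerOpAdj_eq_zero fun a ha => hA0 α a ?_
      have h0 := ha 0
      have h1 := ha 1
      omega
  -- Outside the box nothing survives: membership in `S₁` bounds the `z₂`-degree by `n`, and `A` and
  -- `P(conj Θ A)` both have `z₁`-degree below `m`, giving degree below `2m` after multiplication by
  -- `p` and `p̃`.
  have hD0 : D (A α) = 0 := by
    refine torus_ext fun k => ?_
    rw [map_zero]
    by_cases hk : ∃ i, k i < 0
    · rw [hDx]
      exact mem_hardyBidisk.1 (polyOp_mem p (hp.le_hardyBidisk (hS.fst_le hx))) k hk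
    push Not at hk
    by_cases hk1 : (n : ℤ) ≤ k 1
    · rw [hDx]
      exact hp.torusCoeff_polyOp_of_mem_fst hS hx hk1
    by_cases hk0 : (2 * m : ℤ) ≤ k 0
    · change torusCoeff k (polyOp p (A α) - polyOp (reflection m n p) (R (A α))) = 0
      rw [map_sub, torusCoeff_polyOp_eq_zero (i := 0) (r := m) hp.degree_fst
        (fun l hl => hA0 α l (by omega)) (by omega),
        torusCoeff_polyOp_eq_zero (i := 0) (r := m) (D := m) (degreeOf_reflection_le m n p 0)
        (fun l hl => hR0 l (by omega)) (by omega), sub_zero]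
    · have h0 := hk 0
      have h1 := hk 1
      have hk2 : k = ![(((k 0).toNat : ℕ) : ℤ), (((k 1).toNat : ℕ) : ℤ)] := by
        funext i
        fin_cases i
        · simp [h0]
        · simp [h1]
      rw [hk2]
      exact hα2 ⟨(k 0).toNat, by omega⟩ ⟨(k 1).toNat, by omega⟩
  obtain ⟨a, ha, ha1⟩ := exists_polyFn_eq (hAH α) ![m - 1, N] (fun k i hi => by
    refine hA0 α k ?_
    fin_cases i
    · simp at hi; omega
    · simp at hi; omega)
  obtain ⟨r, hr, -⟩ := exists_polyFn_eq (f := R (A α)) (hardyProj_mem _) ![m, N] (fun k i hi => by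
    refine hR0 k ?_
    fin_cases i
    · simp at hi; omega
    · simp at hi; omega)
  have hmul : p * a = reflection m n p * r := by
    refine polyFn_injective ?_
    rw [← polyOp_polyFn, ← polyOp_polyFn, ha, hr, ← sub_eq_zero]
    exact hD0
  have hdvd : reflection m n p ∣ a :=
    hp.coprime.symm.dvd_of_dvd_mul_left (hmul ▸ dvd_mul_right _ _)
  have ha0 : a ≠ 0 := by
    rintro rfl
    refine hα0 (funext fun b => ?_)
    have h1 := hA α (χ b)
    rw [← ha, torusCoeff_polyFn] at h1
    simp only [hχ.eq_iff, Finset.sum_ite_eq, Finset.mem_univ, if_true] at h1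
    simpa using h1.symm
  obtain ⟨c, rfl⟩ := hdvd
  -- A nonzero multiple of `p̃` has `z₁`-degree at least `m`, while `A` has degree at most `m - 1`,
  -- and `m > 0` since `d < m`.
  have hdeg := degreeOf_mul_eq (n := 0) (left_ne_zero_of_mul ha0) (right_ne_zero_of_mul ha0)
  have h1 := le_degreeOf_reflection hp
  have h2 := ha1 0
  simp only [Matrix.cons_val_zero] at h2
  omega

end IsInnerDenominator

/-! ### Functions of `z₂` alone -/

/-- The preimage is the adjoint of the embedding applied to `f`, whose coefficients are those of `f`
at `z₁`-index zero. -/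
theorem exists_sndEmb_eq {f : L2Torus} (h : ∀ k, k 0 ≠ 0 → torusCoeff k f = 0) :
    ∃ g, sndEmb g = f := by
  let J : L2Circle →L[ℂ] L2Torus := sndEmb.toContinuousLinearMap
  have hJ : ∀ b, circleCoeff b (ContinuousLinearMap.adjoint J f) =
      torusCoeff (Pi.single 1 b) f := fun b => by
    rw [circleCoeff_apply, ContinuousLinearMap.adjoint_inner_right, torusCoeff_apply,
      ← sndEmb_circleChar]
    rfl
  refine ⟨ContinuousLinearMap.adjoint J f, torus_ext fun k => ?_⟩
  rw [torusCoeff_sndEmb, hJ]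
  split_ifs with hk
  · congr 2
    funext i
    fin_cases i
    · simp [hk]
    · simp
  · rw [h k hk]

theorem torusCoeff_polyFn_fstCoeff (q : MvPolynomial (Fin 2) ℂ) {k : Fin 2 → ℤ} {k₀ : ℕ}
    (hk : k 0 = k₀) :
    torusCoeff k (polyFn q) = circleCoeff (k 1) (circlePolyFn (fstCoeff k₀ q)) := by
  have h0 : torusChar 0 = sndEmb (circleChar 0) := by rw [sndEmb_circleChar, Pi.single_zero]
  rw [polyFn, h0, torusCoeff_polyOp_sndEmb q _ hk, circlePolyFn]

theorem circlePolyFn_sub (P Q : Polynomial ℂ) :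
    circlePolyFn (P - Q) = circlePolyFn P - circlePolyFn Q := by
  rw [eq_sub_iff_add_eq, circlePolyFn, circlePolyFn, circlePolyFn, ← circlePolyOp_add,
    sub_add_cancel]

theorem circlePolyOp_comm (P Q : Polynomial ℂ) (f : L2Circle) :
    circlePolyOp P (circlePolyOp Q f) = circlePolyOp Q (circlePolyOp P f) :=
  mulOp_comm _ _ f

/-- Elimination in a system of linear equations with polynomial coefficients. -/
theorem circlePolyOp_eq_of_mul_eq_smul_one {m : ℕ} {Q B : Matrix (Fin m) (Fin m) (Polynomial ℂ)}
    {δ D : Polynomial ℂ} (hB : B * Q = δ • (1 : Matrix (Fin m) (Fin m) (Polynomial ℂ)))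
    {R : Fin m → Polynomial ℂ} {G : Fin m → L2Circle}
    (h : ∀ k, circlePolyOp D (∑ j, circlePolyOp (Q k j) (G j)) = circlePolyFn (R k)) (l : Fin m) :
    circlePolyOp (D * δ) (G l) = circlePolyFn (∑ k, B l k * R k) := by
  have h1 : ∀ k, circlePolyFn (B l k * R k) =
      ∑ j, circlePolyOp (B l k * (D * Q k j)) (G j) := fun k => by
    rw [← circlePolyOp_circlePolyFn, ← h, map_sum, map_sum]
    refine Finset.sum_congr rfl fun j _ => ?_
    rw [circlePolyOp_mul (B l k), circlePolyOp_mul D]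
  have h2 : ∀ j, ∑ k, B l k * (D * Q k j) = D * (δ • (1 : Matrix _ _ (Polynomial ℂ))) l j :=
    fun j => by
      rw [← hB, Matrix.mul_apply, Finset.mul_sum]
      exact Finset.sum_congr rfl fun k _ => by ring
  rw [circlePolyFn_sum, Finset.sum_congr rfl fun k _ => h1 k, Finset.sum_comm,
    Finset.sum_eq_single l]
  · rw [← circlePolyOp_sum, h2, Matrix.smul_apply, Matrix.one_apply_eq, smul_eq_mul, mul_one]
  · intro j _ hj
    rw [← circlePolyOp_sum, h2, Matrix.smul_apply, Matrix.one_apply_ne' hj, smul_zero, mul_zero,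
      circlePolyOp_zero]
  · simp

/-! ### Rationality of the symbol -/

namespace IsInnerDenominator

variable {m n : ℕ} {p : MvPolynomial (Fin 2) ℂ} {S₁ S₂ : Submodule ℂ L2Torus}

theorem fstCoeff_zero_ne_zero (hp : IsInnerDenominator m n p) : fstCoeff 0 p ≠ 0 := by
  intro h
  have h1 := torusCoeff_polyFn_fstCoeff p (k := expo 0) (k₀ := 0) (by simp [expo])
  rw [h, circlePolyFn_zero, map_zero, torusCoeff_polyFn_expo] at h1
  refine hp.ne_zero 0 (by simp) ?_
  rwa [MvPolynomial.eval_zero, constantCoeff_eq]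

/-- The entries of the vector representing the backward shift `B₁ e_i` with respect to an
orthonormal basis of `S₂ ⊖ z₂ S₂` are rational functions of `z₂`. -/
theorem exists_circlePolyOp_backShift (hp : IsInnerDenominator m n p)
    (hS : IsInvariantDecomposition hp.model S₁ S₂) {e : Fin m → L2Torus}
    {U : hardyVec m ≃ₗᵢ[ℂ] S₂}
    (hU : ∀ a, (U (hardyVecChar m a) : L2Torus) = shift 1 a.2 (e a.1))
    {q : Fin m → MvPolynomial (Fin 2) ℂ} (hq : ∀ i, polyFn (q i) = polyOp p (e i))
    {i : Fin m} (hi : e i ∈ hardyBidisk) {G : hardyVec m}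
    (hG : (U G : L2Torus) = backShift 0 (e i)) (l : Fin m) :
    ∃ a b : Polynomial ℂ, (∀ z : ℂ, ‖z‖ ≤ 1 → b.eval z ≠ 0) ∧
      circlePolyOp b ((G : L2CircleVec m) l) = circlePolyFn a := by
  obtain ⟨g, hg⟩ := exists_sndEmb_eq (f := e i - shift 0 1 (backShift 0 (e i)))
    fun k hk => torusCoeff_sub_shift_backShift 0 hi hk
  -- With `g = e_i - z₁B₁e_i`, a function of `z₂`, this says `z₁ p (U G) = q_i - p g`. The power
  -- `z₁^0` gives `g` (`h0`), and `z₁^(k+1)` gives one linear equation for `G` for each `k` (`hk`).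
  have hdec : shift 0 1 (polyOp p (U G)) = polyFn (q i) - polyOp p (sndEmb g) := by
    rw [hg, hq, ← map_sub, sub_sub_cancel, polyOp_shift, hG]
  have h0 : circlePolyOp (fstCoeff 0 p) g = circlePolyFn (fstCoeff 0 (q i)) := by
    refine circle_ext fun b => ?_
    have h1 := congrArg (torusCoeff ![0, b]) hdec
    rw [torusCoeff_shift, mem_hardyBidisk.1 (polyOp_mem p (hG ▸ backShift_mem 0 _)) _
      ⟨0, by simp⟩, map_sub, torusCoeff_polyFn_fstCoeff (k₀ := 0) _ (by simp),
      torusCoeff_polyOp_sndEmb (k₀ := 0) _ _ (by simp), eq_comm, sub_eq_zero] at h1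
    exact h1.symm
  have hk : ∀ k : ℕ, ∑ j, circlePolyOp (fstCoeff k (q j)) ((G : L2CircleVec m) j) =
      circlePolyFn (fstCoeff (k + 1) (q i)) - circlePolyOp (fstCoeff (k + 1) p) g := by
    intro k
    refine circle_ext fun b => ?_
    have h1 := congrArg (torusCoeff ![((k + 1 : ℕ) : ℤ), b]) hdec
    rw [torusCoeff_shift, polyOp_unitary hU hq, map_sum, map_sub,
      torusCoeff_polyFn_fstCoeff (k₀ := k + 1) _ (by simp),
      torusCoeff_polyOp_sndEmb (k₀ := k + 1) _ _ (by simp)] at h1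
    rw [map_sum, map_sub]
    refine Eq.trans (Finset.sum_congr rfl fun j _ => ?_) h1
    rw [torusCoeff_polyOp_sndEmb (k₀ := k) _ _ (by simp)]
    simp
  let Q : Matrix (Fin m) (Fin m) (Polynomial ℂ) := Matrix.of fun k j => fstCoeff k (q j)
  have hdet : Q.det ≠ 0 := by
    rw [Ne, ← Matrix.exists_mulVec_eq_zero_iff]
    rintro ⟨v, hv0, hv⟩
    exact hv0 (hp.eq_zero_of_fstCoeff_mulVec hS hU hq fun k hk => congrFun hv ⟨k, hk⟩)
  -- Cramer's rule: multiplying by the `z₁^0`-coefficient of `p` removes `g`, and the adjugate of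
  -- `Q` isolates each entry, with common denominator that coefficient times `det Q`.
  refine exists_eq_div_of_mem_hardyDisk (mul_ne_zero hp.fstCoeff_zero_ne_zero hdet) (G.2 l)
    (circlePolyOp_eq_of_mul_eq_smul_one (Q := Q) (Matrix.adjugate_mul Q) (D := fstCoeff 0 p) (G := fun j => (G : L2CircleVec m) j)
      (R := fun k => fstCoeff 0 p * fstCoeff (k + 1) (q i) -
        fstCoeff (k + 1) p * fstCoeff 0 (q i)) (fun k => ?_) l)
  simp only [Q, Matrix.of_apply]
  rw [hk, map_sub, circlePolyOp_circlePolyFn, circlePolyOp_comm, h0, circlePolyOp_circlePolyFn,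
    circlePolyFn_sub]

/-! ### Existence of the orthonormal basis -/

theorem ae_eq_div_of_polyOp (hp : IsInnerDenominator m n p) {q : MvPolynomial (Fin 2) ℂ}
    {x : L2Torus} (h : polyFn q = polyOp p x) :
    x =ᵐ[torusMeasure] fun x => eval (torusPt x) q / eval (torusPt x) p := by
  have h1 := coeFn_mulOp _ (memLp_eval p) x
  change polyOp p x =ᵐ[torusMeasure] _ at h1
  rw [← h] at h1
  filter_upwards [h1, coeFn_polyFn q, hp.ae_ne_zero] with x h1 h2 h3
  rw [eq_div_iff h3, ← h2, h1, mul_comm]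

theorem polyOp_of_ae_eq_div (hp : IsInnerDenominator m n p) {q : MvPolynomial (Fin 2) ℂ}
    {x : L2Torus}
    (h : x =ᵐ[torusMeasure] fun x => eval (torusPt x) q / eval (torusPt x) p) :
    polyFn q = polyOp p x := by
  refine (mulOp_eq_of_ae _ ?_).symm
  filter_upwards [h, coeFn_polyFn q, hp.ae_ne_zero] with x h1 h2 h3
  rw [h1, h2, mul_div_cancel₀ _ h3]

/-- `x` is determined by `p x`, whose coefficients are confined to an `m × (n+1)` box. -/
theorem finiteDimensional_wandering (hp : IsInnerDenominator m n p)
    (hS : IsInvariantDecomposition hp.model S₁ S₂) : FiniteDimensional ℂ (wandering S₂) := by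
  let Φ : wandering S₂ →ₗ[ℂ] (Fin m × Fin (n + 1) → ℂ) :=
    LinearMap.pi fun k => (torusCoeff ![(k.1 : ℤ), (k.2 : ℤ)] ∘L polyOp p).toLinearMap ∘ₗ
      (wandering S₂).subtype
  refine Module.Finite.of_injective Φ ((injective_iff_map_eq_zero _).2 fun x hx => ?_)
  have hxS := (mem_wandering.1 x.2).1
  refine Subtype.ext (hp.polyOp_injective (Eq.trans (torus_ext fun k => ?_) (map_zero _).symm))
  rw [map_zero]
  by_cases hk : ∃ i, k i < 0
  · exact mem_hardyBidisk.1 (polyOp_mem p (hp.le_hardyBidisk (hS.snd_le hxS))) k hk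
  push Not at hk
  by_cases hk0 : (m : ℤ) ≤ k 0
  · exact hp.torusCoeff_polyOp_of_mem_snd hS hxS hk0
  by_cases hk1 : (n : ℤ) < k 1
  · exact hp.torusCoeff_polyOp_of_mem_wandering hS x.2 hk1
  have h0 := hk 0
  have h1 := hk 1
  have hk2 : k = ![(((k 0).toNat : ℕ) : ℤ), (((k 1).toNat : ℕ) : ℤ)] := by
    funext i
    fin_cases i
    · simp [h0]
    · simp [h1]
  rw [hk2]
  exact congrFun hx (⟨(k 0).toNat, by omega⟩, ⟨(k 1).toNat, by omega⟩)

/-- The unitary and the numerators are set up for a basis of unknown length, and the two counts then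
identify that length with `m`. -/
theorem exists_orthonormal_wandering (hp : IsInnerDenominator m n p)
    (hS : IsInvariantDecomposition hp.model S₁ S₂) [CompleteSpace S₂] :
    ∃ e : Fin m → L2Torus, Orthonormal ℂ e ∧
      Submodule.span ℂ (Set.range e) = wandering S₂ := by
  have := hp.finiteDimensional_wandering hS
  let b := stdOrthonormalBasis ℂ (wandering S₂)
  let e : Fin (Module.finrank ℂ (wandering S₂)) → L2Torus := fun i => b i
  have he : Orthonormal ℂ e := b.orthonormal.comp_linearIsometry (wandering S₂).subtypeₗᵢ
  have hspan : Submodule.span ℂ (Set.range e) = wandering S₂ := by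
    have h1 : Submodule.span ℂ (Set.range b) = ⊤ := by
      simpa using b.toBasis.span_eq
    have h2 := congrArg (Submodule.map (wandering S₂).subtype) h1
    rw [Submodule.map_span, ← Set.range_comp, Submodule.map_top, Submodule.range_subtype] at h2
    exact h2
  have heW : ∀ i, e i ∈ wandering S₂ := fun i => (b i).2
  choose q hq using fun i => hp.exists_polyFn_of_mem_wandering hS (heW i)
  obtain ⟨U, hU⟩ := exists_unitary (fun l s hs => hS.shift_mem_snd l hs)
    (hS.snd_le.trans hp.le_hardyBidisk) he hspan
  have hd : Module.finrank ℂ (wandering S₂) = m :=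
    le_antisymm (hp.card_le hS hU hq) (hp.le_card hS hspan)
  refine ⟨e ∘ Fin.cast hd.symm, he.comp _ (Fin.cast_injective _), ?_⟩
  rw [Set.range_comp, (finCongr hd.symm).surjective.range_eq (f := Fin.cast hd.symm),
    Set.image_univ, hspan]

theorem exists_isWanderingBasis (hp : IsInnerDenominator m n p)
    (hS : IsInvariantDecomposition hp.model S₁ S₂) [CompleteSpace S₂] :
    ∃ q : Fin m → MvPolynomial (Fin 2) ℂ, IsWanderingBasis p S₂ q ∧
      ∀ i, (q i).degreeOf 0 ≤ m - 1 ∧ (q i).degreeOf 1 ≤ n := by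
  obtain ⟨e, he, hspan⟩ := hp.exists_orthonormal_wandering hS
  have heW : ∀ i, e i ∈ wandering S₂ := fun i => hspan ▸ Submodule.subset_span ⟨i, rfl⟩
  choose q hq using fun i => hp.exists_polyFn_of_mem_wandering hS (heW i)
  exact ⟨q, ⟨e, fun i => hp.ae_eq_div_of_polyOp (hq i), he, hspan⟩,
    fun i => hp.degreeOf_of_mem_wandering hS (heW i) (hq i)⟩

/-- The pointwise formula for the unitary operator `H²(𝔻)^d → S₂`. -/
theorem unitary_ae_eq (hp : IsInnerDenominator m n p) {S : Submodule ℂ L2Torus} {d : ℕ}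
    {e : Fin d → L2Torus} {U : hardyVec d ≃ₗᵢ[ℂ] S}
    (hU : ∀ a, (U (hardyVecChar d a) : L2Torus) = shift 1 a.2 (e a.1))
    {q : Fin d → MvPolynomial (Fin 2) ℂ} (hq : ∀ i, polyFn (q i) = polyOp p (e i))
    (f : hardyVec d) :
    ((U f : L2Torus) : UnitAddTorus (Fin 2) → ℂ) =ᵐ[torusMeasure] fun x =>
      ∑ i, eval (torusPt x) (q i) / eval (torusPt x) p * (f : L2CircleVec d) i (x 1) := by
  have h1 := coeFn_mulOp _ (memLp_eval p) (U f : L2Torus)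
  change polyOp p (U f) =ᵐ[torusMeasure] _ at h1
  rw [polyOp_unitary hU hq] at h1
  have h2 : ∀ᵐ x ∂torusMeasure, ∀ i,
      (polyOp (q i) (sndEmb ((f : L2CircleVec d) i)) : L2Torus) x =
        eval (torusPt x) (q i) * (f : L2CircleVec d) i (x 1) := by
    rw [ae_all_iff]
    intro i
    filter_upwards [coeFn_mulOp _ (memLp_eval (q i)) (sndEmb ((f : L2CircleVec d) i)),
      coeFn_sndEmb ((f : L2CircleVec d) i)] with x h3 h4
    rw [polyOp, h3, h4]
  filter_upwards [h1, h2, hp.ae_ne_zero,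
    coeFn_Lp_sum Finset.univ fun i => polyOp (q i) (sndEmb ((f : L2CircleVec d) i))]
    with x h1 h2 h3 h4
  rw [← mul_right_inj' h3, ← h1, h4, Finset.mul_sum]
  refine Finset.sum_congr rfl fun i _ => ?_
  rw [h2]
  field_simp

end IsInnerDenominator

/-! ### The matrix of the compression -/

/-- The Toeplitz structure of the matrix of multiplication by `conj g`. When `g` is in `H²`, the
entries with `k > l` vanish. -/
theorem circleCoeff_mulOp_of_ae_eq_conj {φ : UnitAddCircle → ℂ}
    (hφ : MemLp φ ∞ circleMeasure) {g : L2Circle}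
    (h : ∀ᵐ x ∂circleMeasure, φ x = conj (g x)) (k l : ℤ) :
    circleCoeff k (mulOp φ hφ (circleChar l)) = conj (circleCoeff (l - k) g) := by
  rw [← circleCoeff_circleCharOp, circleCoeff_apply, circleCoeff_apply, inner_conj_symm,
    L2.inner_def, L2.inner_def]
  refine integral_congr_ae ?_
  filter_upwards [coeFn_mulOp φ hφ (circleChar l), coeFn_mulOp _ (memLp_fourier k) g, h,
    coeFn_circleChar k] with x h1 h2 h3 h4
  rw [circleCharOp, h1, h2, h3, h4]
  simp only [RCLike.inner_apply, map_mul]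
  ring

theorem inner_toeplitz {d : ℕ} {F : UnitAddCircle → Matrix (Fin d) (Fin d) ℂ}
    (hF : ∀ i j, MemLp (fun x => F x i j) ∞ circleMeasure) (a b : Fin d × ℕ) :
    ⟪hardyVecChar d a, toeplitz F hF (hardyVecChar d b)⟫_ℂ =
      circleCoeff a.2 (mulOp _ (hF a.1 b.1) (circleChar b.2)) := by
  rw [toeplitz, compression, ContinuousLinearMap.comp_apply,
    Submodule.inner_orthogonalProjectionOnto_eq_of_mem_left, inner_hardyVecChar]
  congr 1
  change (∑ j, mulOp _ (hF a.1 j) ∘L PiLp.proj 2 (fun _ : Fin d => L2Circle) j)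
    (hardyVecChar d b : L2CircleVec d) = _
  rw [sum_apply, Finset.sum_eq_single b.1]
  · change mulOp _ (hF a.1 b.1) ((hardyVecChar d b : L2CircleVec d) b.1) = _
    rw [hardyVecChar, PiLp.single_eq_same]
  · intro j _ hj
    change mulOp _ (hF a.1 j) ((hardyVecChar d b : L2CircleVec d) j) = _
    rw [hardyVecChar, PiLp.single_eq_of_ne _ hj, map_zero]
  · simp

namespace IsInnerDenominator

variable {m n : ℕ} {p : MvPolynomial (Fin 2) ℂ} {S₁ S₂ : Submodule ℂ L2Torus}

/-- The matrix entries of the compression of `M_{z₁}` in terms of the backward shift. -/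
theorem inner_shift_coordMul (hp : IsInnerDenominator m n p)
    (hS : IsInvariantDecomposition hp.model S₁ S₂) {d : ℕ} {e : Fin d → L2Torus}
    (heW : ∀ i, e i ∈ wandering S₂) {U : hardyVec d ≃ₗᵢ[ℂ] S₂}
    (hU : ∀ a, (U (hardyVecChar d a) : L2Torus) = shift 1 a.2 (e a.1)) {i : Fin d}
    {G : hardyVec d} (hG : (U G : L2Torus) = backShift 0 (e i)) (j : Fin d) (k l : ℕ) :
    ⟪shift 1 k (e i), shift 0 1 (shift 1 l (e j))⟫_ℂ =
      conj (circleCoeff ((l : ℤ) - k) ((G : L2CircleVec d) j)) := by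
  have heS : ∀ i, e i ∈ S₂ := fun i => (mem_wandering.1 (heW i)).1
  have heH : ∀ i, e i ∈ hardyBidisk := fun i => hp.le_hardyBidisk (hS.snd_le (heS i))
  rw [← inner_conj_symm]
  congr 1
  -- For `k ≤ l`, cancelling `z₂^k` leaves an inner product of `B₁e_i` with `z₂^(l-k) e_j`, a
  -- coefficient of `G`. For `k > l` both sides are zero.
  rcases le_or_gt k l with hkl | hkl
  · obtain ⟨s, rfl⟩ := Nat.exists_eq_add_of_le hkl
    have h1 := inner_backShift 0 (shift_mem 1 s (heH j)) (e i)
    rw [inner_shift_right, shift_comm 1 0, shift_shift, Nat.cast_add, neg_add_cancel_left, ← h1,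
      add_sub_cancel_left, ← hG, ← hU (j, s), ← Submodule.coe_inner,
      U.inner_map_map, Submodule.coe_inner, inner_hardyVecChar]
  · obtain ⟨r, rfl⟩ := Nat.exists_eq_add_of_lt hkl
    rw [mem_hardyDisk.1 (G.2 j) _ (by push_cast; omega), shift_comm 0 1, inner_shift_left,
      shift_shift,
      show -(l : ℤ) + ((l + r + 1 : ℕ) : ℤ) = 1 + r by push_cast; ring]
    -- The part `z₁B₁e_i` contributes an inner product of an element of `z₂S₂` with `e_j`, which is
    -- zero. The rest has `z₁`-index zero only, whereas `z₁e_j` starts at index one.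
    have hdec : e i = shift 0 1 (backShift 0 (e i)) + (e i - shift 0 1 (backShift 0 (e i))) := by
      abel
    rw [hdec, map_add, inner_add_right, shift_comm 1 0, inner_shift_left, shift_shift,
      neg_add_cancel, shift_zero, ← shift_shift, ← inner_conj_symm,
      (mem_wandering.1 (heW j)).2 _ (hS.shift_mem_snd r (hp.backShift_mem_snd hS (heS i))),
      map_zero, zero_add]
    refine inner_eq_zero_of_torusCoeff fun a => ?_
    rw [torusCoeff_shift, torusCoeff_shift]
    by_cases ha : a 0 = 0
    · exact Or.inl (mem_hardyBidisk.1 (heH j) _ ⟨0, by simp [ha]⟩)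
    · exact Or.inr (torusCoeff_sub_shift_backShift 0 (heH i) (by simpa using ha))

/-- The compression of `M_{z₁}` to `S₂` is unitarily equivalent to a Toeplitz operator. -/
theorem compression_eq_toeplitz (hp : IsInnerDenominator m n p)
    (hS : IsInvariantDecomposition hp.model S₁ S₂) [CompleteSpace S₂] {d : ℕ}
    {e : Fin d → L2Torus} (heW : ∀ i, e i ∈ wandering S₂) {U : hardyVec d ≃ₗᵢ[ℂ] S₂}
    (hU : ∀ a, (U (hardyVecChar d a) : L2Torus) = shift 1 a.2 (e a.1))
    {G : Fin d → hardyVec d} (hG : ∀ i, (U (G i) : L2Torus) = backShift 0 (e i))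
    {F : UnitAddCircle → Matrix (Fin d) (Fin d) ℂ}
    (hF : ∀ i j, MemLp (fun x => F x i j) ∞ circleMeasure)
    (hFG : ∀ i j, ∀ᵐ x ∂circleMeasure, F x i j = conj ((G i : L2CircleVec d) j x)) :
    compression S₂ (coordMul 0) = (U : hardyVec d →L[ℂ] S₂) ∘L toeplitz F hF ∘L
      ContinuousLinearMap.adjoint (U : hardyVec d →L[ℂ] S₂) := by
  have hentry : ∀ a b, ⟪hardyVecChar d a,
      U.symm (compression S₂ (coordMul 0) (U (hardyVecChar d b)))⟫_ℂ =
        ⟪hardyVecChar d a, toeplitz F hF (hardyVecChar d b)⟫_ℂ := by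
    intro a b
    rw [inner_toeplitz, circleCoeff_mulOp_of_ae_eq_conj (hF a.1 b.1) (hFG a.1 b.1),
      ← hp.inner_shift_coordMul hS heW hU (hG a.1), ← U.inner_map_map,
      LinearIsometryEquiv.apply_symm_apply, compression, ContinuousLinearMap.comp_apply,
      Submodule.inner_orthogonalProjectionOnto_eq_of_mem_left, hU,
      ContinuousLinearMap.comp_apply, Submodule.subtypeL_apply, hU, coordMul_eq_shift]
  have hcomp : (U.symm : S₂ →L[ℂ] hardyVec d) ∘L compression S₂ (coordMul 0) ∘L
      (U : hardyVec d →L[ℂ] S₂) = toeplitz F hF := by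
    refine hardyVec_clm_ext fun b => (hardyVecBasis d).repr.injective
      (lp.ext (funext fun a => ?_))
    rw [HilbertBasis.repr_apply_apply, HilbertBasis.repr_apply_apply, hardyVecBasis_apply]
    exact hentry a b
  rw [LinearIsometryEquiv.adjoint_eq_symm, ← hcomp]
  refine ContinuousLinearMap.ext fun x => ?_
  change _ = U (U.symm (compression S₂ (coordMul 0) (U (U.symm x))))
  rw [LinearIsometryEquiv.apply_symm_apply, LinearIsometryEquiv.apply_symm_apply]

end IsInnerDenominator

/-! ### Rational functions of `conj z` -/

theorem eval_map_conj (P : Polynomial ℂ) (z : ℂ) :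
    (P.map (starRingEnd ℂ)).eval (conj z) = conj (P.eval z) := by
  rw [Polynomial.eval_map, Polynomial.eval₂_at_apply]

theorem isRationalInConj_conj_div {a b : Polynomial ℂ} (hb : ∀ z : ℂ, ‖z‖ ≤ 1 → b.eval z ≠ 0) :
    IsRationalInConj fun z => conj (a.eval z / b.eval z) := by
  refine ⟨a.map (starRingEnd ℂ), b.map (starRingEnd ℂ), fun z hz => ?_⟩
  rw [eval_map_conj, eval_map_conj]
  exact ⟨(map_ne_zero _).2 (hb z (by simpa using hz)), map_div₀ _ _ _⟩

theorem continuousOn_conj_div {a b : Polynomial ℂ} (hb : ∀ z : ℂ, ‖z‖ ≤ 1 → b.eval z ≠ 0) :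
    ContinuousOn (fun z => conj (a.eval z / b.eval z)) (Metric.closedBall 0 1) :=
  Complex.continuous_conj.comp_continuousOn
    (a.continuous.continuousOn.div b.continuous.continuousOn fun z hz => hb z (by simpa using hz))

theorem memLp_comp_circlePt {g : ℂ → ℂ} (hg : ContinuousOn g (Metric.closedBall 0 1)) :
    MemLp (fun x => g (circlePt x)) ∞ circleMeasure := by
  have hc : Continuous fun x => g (circlePt x) :=
    hg.comp_continuous continuous_circlePt fun x => by simp [norm_circlePt]
  obtain ⟨C, hC⟩ := isCompact_univ.exists_bound_of_continuousOn hc.continuousOn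
  exact memLp_top_of_bound hc.aestronglyMeasurable C (.of_forall fun x => hC x (Set.mem_univ x))

theorem ae_eq_div_of_circlePolyOp {a b : Polynomial ℂ} (hb : ∀ z : ℂ, ‖z‖ ≤ 1 → b.eval z ≠ 0)
    {g : L2Circle} (h : circlePolyOp b g = circlePolyFn a) :
    ∀ᵐ x ∂circleMeasure, g x = a.eval (circlePt x) / b.eval (circlePt x) := by
  have h1 := coeFn_mulOp _ (memLp_circle_eval b) g
  change circlePolyOp b g =ᵐ[circleMeasure] _ at h1
  rw [h] at h1
  filter_upwards [h1, coeFn_circlePolyFn a] with x h1 h2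
  rw [eq_div_iff (hb _ (norm_circlePt x).le), ← h2, h1, mul_comm]

/-- Functions in `L²` of the circle that are rational without poles in the closed disk have complex
conjugates that extend continuously to the closed disk as rational functions of `conj z`. -/
theorem exists_matrix_isRationalInConj {d : ℕ} {g : Fin d → Fin d → L2Circle}
    (h : ∀ i j, ∃ a b : Polynomial ℂ, (∀ z : ℂ, ‖z‖ ≤ 1 → b.eval z ≠ 0) ∧
      circlePolyOp b (g i j) = circlePolyFn a) :
    ∃ M : ℂ → Matrix (Fin d) (Fin d) ℂ,
      (∀ i j, IsRationalInConj fun z => M z i j) ∧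
      (∀ i j, ContinuousOn (fun z => M z i j) (Metric.closedBall 0 1)) ∧
      ∀ i j, ∀ᵐ x ∂circleMeasure, M (circlePt x) i j = conj (g i j x) := by
  choose a b hb hab using h
  refine ⟨fun z i j => conj ((a i j).eval z / (b i j).eval z),
    fun i j => isRationalInConj_conj_div (hb i j), fun i j => continuousOn_conj_div (hb i j),
    fun i j => ?_⟩
  filter_upwards [ae_eq_div_of_circlePolyOp (hb i j) (hab i j)] with x hx
  rw [hx]

end BidiskModel

end

/-! ### The theorem -/

theorem theorem3p2 (m n : ℕ) (p : MvPolynomial (Fin 2) ℂ)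
    (hp : BidiskModel.IsInnerDenominator m n p)
    (S₁ S₂ : Submodule ℂ BidiskModel.L2Torus) [CompleteSpace S₂]
    (hS : BidiskModel.IsInvariantDecomposition
      (BidiskModel.modelSpace
        (fun x => BidiskModel.rationalInner m n p (BidiskModel.torusPt x)) hp.memLp) S₁ S₂) :
    (∃ q : Fin m → MvPolynomial (Fin 2) ℂ, BidiskModel.IsWanderingBasis p S₂ q ∧
      ∀ i, (q i).degreeOf 0 ≤ m - 1 ∧ (q i).degreeOf 1 ≤ n) ∧
    ∀ q : Fin m → MvPolynomial (Fin 2) ℂ, BidiskModel.IsWanderingBasis p S₂ q →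
      ∃ U : BidiskModel.hardyVec m ≃ₗᵢ[ℂ] S₂,
        (∀ f : BidiskModel.hardyVec m,
          ((U f : BidiskModel.L2Torus) : UnitAddTorus (Fin 2) → ℂ)
            =ᵐ[BidiskModel.torusMeasure] fun x =>
              ∑ i, MvPolynomial.eval (BidiskModel.torusPt x) (q i) /
                MvPolynomial.eval (BidiskModel.torusPt x) p *
                (f : BidiskModel.L2CircleVec m) i (x 1)) ∧
        ∃ M : ℂ → Matrix (Fin m) (Fin m) ℂ,
          (∀ i j, BidiskModel.IsRationalInConj fun z => M z i j) ∧
          (∀ i j, ContinuousOn (fun z => M z i j) (Metric.closedBall 0 1)) ∧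
          ∃ hM : ∀ i j, MemLp (fun x => M (BidiskModel.circlePt x) i j) ∞
              BidiskModel.circleMeasure,
            BidiskModel.compression S₂ (BidiskModel.coordMul 0) =
              (U : BidiskModel.hardyVec m →L[ℂ] S₂) ∘L
                BidiskModel.toeplitz (fun x => M (BidiskModel.circlePt x)) hM ∘L
                ContinuousLinearMap.adjoint (U : BidiskModel.hardyVec m →L[ℂ] S₂) := by
  refine ⟨hp.exists_isWanderingBasis hS, fun q ⟨e, hqe, he, hspan⟩ => ?_⟩
  have heW : ∀ i, e i ∈ BidiskModel.wandering S₂ := fun i =>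
    hspan ▸ Submodule.subset_span ⟨i, rfl⟩
  have heS : ∀ i, e i ∈ S₂ := fun i => (BidiskModel.mem_wandering.1 (heW i)).1
  have hq := fun i => hp.polyOp_of_ae_eq_div (hqe i)
  obtain ⟨U, hU⟩ := BidiskModel.exists_unitary (fun l s hs => hS.shift_mem_snd l hs)
    (hS.snd_le.trans hp.le_hardyBidisk) he hspan
  refine ⟨U, hp.unitary_ae_eq hU hq, ?_⟩
  -- `G_i = U* B₁ e_i`; the conjugates of its entries form row `i` of the symbol.
  let G : Fin m → BidiskModel.hardyVec m := fun i =>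
    U.symm ⟨BidiskModel.backShift 0 (e i), hp.backShift_mem_snd hS (heS i)⟩
  have hG : ∀ i, (U (G i) : BidiskModel.L2Torus) = BidiskModel.backShift 0 (e i) := fun i => by
    rw [LinearIsometryEquiv.apply_symm_apply]
  obtain ⟨M, hMr, hMc, hMG⟩ := BidiskModel.exists_matrix_isRationalInConj
    (g := fun i j => (G i : BidiskModel.L2CircleVec m) j)
    fun i => hp.exists_circlePolyOp_backShift hS hU hq
      (hp.le_hardyBidisk (hS.snd_le (heS i))) (hG i)
  exact ⟨M, hMr, hMc,
    fun i j => BidiskModel.memLp_comp_circlePt (g := fun z => M z i j) (hMc i j),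
    hp.compression_eq_toeplitz hS heW hU hG _ hMG⟩
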